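/- Let $\Omega\subset\mathbb{R}^3$ be bounded, open and convex (in particular, $\Omega$ may be any such set with $C^1$-boundary and strictly positive curvature; no regularity of the boundary is required), and let $D=\operatorname{diam}(\Omega)$. Write $\mathbb{R}_+=(0,\infty)$, and let $dn$ be the surface measure on the unit sphere $\mathbb{S}^2\subset\mathbb{R}^3$. For a measure space $X$, $L^\infty(X,L^1(\mathbb{R}_+))$ is the space of (classes of) jointly measurable $g(x,\nu)$ with $\|g\|_{L^\infty(X,L^1(\mathbb{R}_+))}=\operatorname{ess\,sup}_{x\in X}\int_0^\infty|g(x,\nu)|\,d\nu<\infty$. Functions on $\Omega$ are extended by $0$ to $\mathbb{R}^3$. A sequence in $L^2(\Omega)$ is called compact if it is relatively compact there. Let $(\varphi_j)_{j\in\mathbb{N}}$ and $(\psi_j)_{j\in\mathbb{N}}$ be bounded sequences of non-negative functions in $L^\infty(\Omega,L^1(\mathbb{R}_+))$, and let $f\in L^\infty(\mathbb{S}^2,L^1(\mathbb{R}_+))$ be non-negative. Then the sequences $$\int_{\mathbb{S}^2}dn\int_0^D dr\int_0^\infty d\nu\;\varphi_j(x-rn,\nu)\exp\Big(-\int_0^r\psi_j(x-\lambda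 n,\nu)\,d\lambda\Big)$$ and $$\int_{\mathbb{S}^2}dn\int_0^\infty d\nu\;f(n,\nu)\exp\Big(-\int_0^D\psi_j(x-\lambda n,\nu)\,d\lambda\Big)$$ are compact in $L^2(\Omega)$. Moreover, let $(\varphi_j)_{j\in\mathbb{N}}$ be instead a sequence of non-negative functions $\varphi_j(x,\nu,\omega)$, $(x,\nu,\omega)\in\Omega\times\mathbb{R}_+\times\mathbb{S}^2$, that are jointly measurable and bounded in $L^\infty(\Omega,L^1(\mathbb{R}_+))$ uniformly in $j$ and $\omega$, such that $$\|\varphi_j(\cdot,\cdot,\omega_1)-\varphi_j(\cdot,\cdot,\omega_2)\|_{L^\infty(\Omega,L^1(\mathbb{R}_+))}\le\sigma(d(\omega_1,\omega_2))\qquad\text{for all } j\in\mathbb{N},\ \omega_1,\omega_2\in\mathbb{S}^2,$$ where $d$ is the geodesic distance on $\mathbb{S}^2$ and $\sigma:[0,\infty)\to[0,\infty)$ is continuous with $\sigma(0)=0$ (so that $\varphi_j\in C(\mathbb{S}^2,L^\infty(\Omega,L^1(\mathbb{R}_+)))$). Then the sequence $$\int_{\mathbb{S}^2}dn\int_0^D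 dr\int_0^\infty d\nu\;\varphi_j(x-rn,\nu,n)\exp\Big(-\int_0^r\psi_j(x-\lambda n,\nu)\,d\lambda\Big)$$ is also compact in $L^2(\Omega)$. In all three cases the integrals converge absolutely for almost every $x\in\Omega$, and the line integrals in the exponents are finite for almost every $(n,\nu)$. -/

import Mathlib

open MeasureTheory Set
open scoped ENNReal NNReal

/-- Three-dimensional Euclidean space. -/
abbrev E3 : Type := EuclideanSpace ℝ (Fin 3)

/-- The unit sphere of `E3`. -/
abbrev S2 : Type := Metric.sphere (0 : E3) 1

/-- The surface measure `dn` on the unit sphere (total mass `4π`). -/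
noncomputable def sphereMeasure : Measure S2 := (volume : Measure E3).toSphere

/-- Lebesgue measure `dν` on the half-line of frequencies. -/
noncomputable def freqMeasure : Measure ℝ := volume.restrict (Ioi 0)

/-- The norm of `L^∞(X, L¹(ℝ₊))`: the essential supremum over `x` of `∫₀^∞ |g(x, ν)| dν`. -/
noncomputable def linftyL1Norm {X : Type*} [MeasurableSpace X] (μ : Measure X)
    (g : X → ℝ → ℝ) : ℝ≥0∞ :=
  essSup (fun x => ∫⁻ ν, ‖g x ν‖ₑ ∂freqMeasure) μ

/-- `g` represents a non-negative element of `L^∞(X, L¹(ℝ₊))` of norm at most `M`. Elements of this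
space are given by functions of `(x, ν)` that are jointly measurable up to null sets. -/
structure IsNonnegLinftyL1 {X : Type*} [MeasurableSpace X] (μ : Measure X)
    (g : X → ℝ → ℝ) (M : ℝ≥0) : Prop where
  aemeasurable : AEMeasurable (fun p : X × ℝ => g p.1 p.2) (μ.prod freqMeasure)
  nonneg : ∀ᵐ p ∂(μ.prod freqMeasure), 0 ≤ g p.1 p.2
  norm_le : linftyL1Norm μ g ≤ M

/-- Extension by zero, in the space variable, of a function on `Ω × ℝ₊`. -/
noncomputable def zeroExt (Ω : Set E3) (g : E3 → ℝ → ℝ) (y : E3) (ν : ℝ) : ℝ :=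
  Ω.indicator (fun z => g z ν) y

/-- The line integral `∫₀^r ψ(x - λ n, ν) dλ`. -/
noncomputable def lineIntegral (Ω : Set E3) (ψ : E3 → ℝ → ℝ) (x : E3) (n : S2) (r ν : ℝ) : ℝ :=
  ∫ l in (0 : ℝ)..r, zeroExt Ω ψ (x - l • (n : E3)) ν

/-- The integrand `φ(x - r n, ν, n) exp (-∫₀^r ψ(x - λ n, ν) dλ)`, where `φ n` is the function
`(y, ν) ↦ φ(y, ν, n)`. -/
noncomputable def interiorIntegrand (Ω : Set E3) (φ : S2 → E3 → ℝ → ℝ) (ψ : E3 → ℝ → ℝ)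
    (x : E3) (n : S2) (r ν : ℝ) : ℝ :=
  zeroExt Ω (φ n) (x - r • (n : E3)) ν * Real.exp (-lineIntegral Ω ψ x n r ν)

/-- `∫_{S²} dn ∫₀^D dr ∫₀^∞ dν φ(x - r n, ν, n) exp (-∫₀^r ψ(x - λ n, ν) dλ)`,
with `D` the diameter of `Ω`. -/
noncomputable def interiorTerm (Ω : Set E3) (φ : S2 → E3 → ℝ → ℝ) (ψ : E3 → ℝ → ℝ)
    (x : E3) : ℝ :=
  ∫ n, (∫ r in (0 : ℝ)..Metric.diam Ω, ∫ ν, interiorIntegrand Ω φ ψ x n r ν ∂freqMeasure)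
    ∂sphereMeasure

/-- The integrand `f(n, ν) exp (-∫₀^D ψ(x - λ n, ν) dλ)`, with `D` the diameter of `Ω`. -/
noncomputable def boundaryIntegrand (Ω : Set E3) (f : S2 → ℝ → ℝ) (ψ : E3 → ℝ → ℝ)
    (x : E3) (n : S2) (ν : ℝ) : ℝ :=
  f n ν * Real.exp (-lineIntegral Ω ψ x n (Metric.diam Ω) ν)

/-- `∫_{S²} dn ∫₀^∞ dν f(n, ν) exp (-∫₀^D ψ(x - λ n, ν) dλ)`. -/
noncomputable def boundaryTerm (Ω : Set E3) (f : S2 → ℝ → ℝ) (ψ : E3 → ℝ → ℝ) (x : E3) : ℝ :=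
  ∫ n, (∫ ν, boundaryIntegrand Ω f ψ x n ν ∂freqMeasure) ∂sphereMeasure

/-- For almost every `x` in `Ω`, the line integral in the exponent converges for almost every
direction and frequency. -/
def LineIntegralsConverge (Ω : Set E3) (ψ : E3 → ℝ → ℝ) : Prop :=
  ∀ᵐ x ∂(volume.restrict Ω), ∀ᵐ q ∂(sphereMeasure.prod freqMeasure),
    IntegrableOn (fun l : ℝ => zeroExt Ω ψ (x - l • (q.1 : E3)) q.2) (Ioc 0 (Metric.diam Ω))

/-- For almost every `x` in `Ω`, the triple integral defining `interiorTerm` converges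
absolutely. -/
def InteriorConverges (Ω : Set E3) (φ : S2 → E3 → ℝ → ℝ) (ψ : E3 → ℝ → ℝ) : Prop :=
  ∀ᵐ x ∂(volume.restrict Ω),
    Integrable (fun q : S2 × ℝ × ℝ => interiorIntegrand Ω φ ψ x q.1 q.2.1 q.2.2)
      (sphereMeasure.prod ((volume.restrict (Ioc 0 (Metric.diam Ω))).prod freqMeasure))

/-- For almost every `x` in `Ω`, the double integral defining `boundaryTerm` converges
absolutely. -/
def BoundaryConverges (Ω : Set E3) (f : S2 → ℝ → ℝ) (ψ : E3 → ℝ → ℝ) : Prop :=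
  ∀ᵐ x ∂(volume.restrict Ω),
    Integrable (fun q : S2 × ℝ => boundaryIntegrand Ω f ψ x q.1 q.2)
      (sphereMeasure.prod freqMeasure)

/-- The sequence `u` lies in `L²(Ω)` and is (relatively) compact there. -/
def CompactInL2 (Ω : Set E3) (u : ℕ → E3 → ℝ) : Prop :=
  ∃ h : ∀ j, MemLp (u j) 2 (volume.restrict Ω),
    IsCompact (closure (range fun j => (h j).toLp (u j)))

open Filter Topology Metric

/-! Each of the sequences is an average over directions, `u_j(x) = ∫ A_j(x, n) dn`, where `A_j(x,
n)` is the intensity arriving at `x` in direction `n`. Physically, moving back by `s` along the ray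
can only remove absorption, and it loses only the radiation emitted on the skipped segment. Hence
`A_j` is non-negative, bounded, and satisfies the one-sided bound `A_j(x, n) ≤ A_j(x - s n, n) + C
s`, with `C` independent of `j`. This is the only information about absorption that survives in the
limit argument; no regularity of the coefficients, in space or in direction, enters.

Compactness then follows from an averaging lemma (`compactInL2_of_ae_eq_dirAvg`). Smear `A`
backwards over `s` uniform in `(0, δ]`. A one-sided bound controls the absolute increment after
integration, because the signed increments telescope under translation; so smearing costs `O(δ)` in
`L¹` on a ball, hence in `L²` by boundedness (`integral_abs_dirAvg_sub_segAvg_le`).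

For fixed `δ` the smeared average is treated by duality (`integral_sq_segAvg_le`,
`integral_segment_sq`): its `L²` norm is controlled by a quadratic form whose kernel is the law of
`(t - s) n`, with `n` distributed by the surface measure and `s, t` independent. In polar
coordinates this law has an `L¹` density. Convolution with an `L¹` kernel turns weak convergence of
bounded, compactly supported functions into uniform convergence on balls, so the form tends to zero
on differences (`eventually_segmentForm_le`). Weak limits are taken along ultrafilters, and relative
compactness is the statement that every ultrafilter makes the sequence Cauchy.

What remains is measure theory: choosing measurable representatives and checking that null sets of
coefficients are invisible on almost every ray. -/

/-! ### Null sets in polar coordinates. -/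

theorem ae_sphere_ae_pos_smul_notMem {N : Set E3} (hN : volume N = 0) :
    ∀ᵐ n : S2 ∂sphereMeasure, ∀ᵐ r : ℝ, 0 < r → r • (n : E3) ∉ N := by
  have hmp := (volume : Measure E3).measurePreserving_homeomorphUnitSphereProd
  have h0 : ∀ᵐ y : ({0}ᶜ : Set E3) ∂(volume : Measure E3).comap (↑), (y : E3) ∉ N := by
    rw [ae_iff]
    have hme : MeasurableEmbedding (Subtype.val : ({0}ᶜ : Set E3) → E3) :=
      MeasurableEmbedding.subtype_coe (measurableSet_singleton _).compl
    rw [hme.comap_apply]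
    refine measure_mono_null ?_ hN
    rintro _ ⟨y, hy, rfl⟩
    simpa using hy
  have hsymm := hmp.symm (homeomorphUnitSphereProd E3).toMeasurableEquiv
  have h1 := hsymm.quasiMeasurePreserving.ae h0
  have h2 := Measure.ae_ae_of_ae_prod h1
  filter_upwards [h2] with n hn
  -- The radial measure has density a power of `r`, which is nonzero on `r > 0`, so its null sets
  -- are Lebesgue null.
  rw [Measure.volumeIoiPow, ae_withDensity_iff (by fun_prop)] at hn
  have hme : MeasurableEmbedding (Subtype.val : Ioi (0 : ℝ) → ℝ) :=
    MeasurableEmbedding.subtype_coe measurableSet_Ioi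
  have h3 : ∀ᵐ r : Ioi (0:ℝ) ∂((volume : Measure ℝ).comap (Subtype.val : Ioi (0:ℝ) → ℝ)),
      (r : ℝ) • (n : E3) ∉ N := by
    filter_upwards [hn] with r hr
    have := hr (by
      have : (0:ℝ) < r := r.2
      simp; positivity)
    simpa [homeomorphUnitSphereProd, Homeomorph.toMeasurableEquiv] using this
  rw [ae_iff, hme.comap_apply] at h3
  rw [ae_iff]
  refine measure_mono_null ?_ h3
  intro r hr
  simp only [Classical.not_imp, mem_ofPred_eq, not_not] at hr
  exact ⟨⟨r, hr.1⟩, by simpa using hr.2, rfl⟩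

theorem ae_sphere_ae_smul_notMem {N : Set E3} (hN : volume N = 0) :
    ∀ᵐ n : S2 ∂sphereMeasure, ∀ᵐ r : ℝ, r • (n : E3) ∉ N := by
  have hN' : volume (Neg.neg ⁻¹' N) = 0 := by rw [Measure.measure_preimage_neg, hN]
  filter_upwards [ae_sphere_ae_pos_smul_notMem hN, ae_sphere_ae_pos_smul_notMem hN'] with n h1 h2
  have h3 := (Measure.measurePreserving_neg (volume : Measure ℝ)).quasiMeasurePreserving.ae h2
  filter_upwards [h1, h3, Measure.ae_ne volume (0 : ℝ)] with r hr1 hr2 hr0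
  rcases lt_or_gt_of_ne hr0 with h | h
  · simpa using hr2 (by linarith)
  · exact hr1 h

/-! ### The difference of two random points on a random segment. -/

instance : IsFiniteMeasure sphereMeasure := by unfold sphereMeasure; infer_instance

instance : SigmaFinite freqMeasure := by unfold freqMeasure; infer_instance

/-- The law of the difference vector `(t - s) n` of two points on a random segment. -/
noncomputable def segmentDiffMeasure (θ : Measure ℝ) : Measure E3 :=
  (sphereMeasure.prod (θ.prod θ)).map fun q => (q.2.2 - q.2.1) • (q.1 : E3)

theorem measurable_segmentDiff :
    Measurable fun q : S2 × ℝ × ℝ => (q.2.2 - q.2.1) • (q.1 : E3) := by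
  fun_prop

instance (θ : Measure ℝ) [IsFiniteMeasure θ] : IsFiniteMeasure (segmentDiffMeasure θ) := by
  unfold segmentDiffMeasure; infer_instance

/-- For almost every direction the line through the origin meets a null set in a null set of
parameters. With `n` and `s` fixed, `t - s` is a translate of `t`, whose law is absolutely
continuous. -/
theorem segmentDiffMeasure_absolutelyContinuous {θ : Measure ℝ} [IsFiniteMeasure θ]
    (hθ : θ ≪ volume) : segmentDiffMeasure θ ≪ volume := by
  refine Measure.AbsolutelyContinuous.mk fun N hNm hN => ?_
  rw [segmentDiffMeasure, Measure.map_apply measurable_segmentDiff hNm]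
  refine Measure.measure_prod_null_of_ae_null (measurable_segmentDiff hNm) ?_
  filter_upwards [ae_sphere_ae_smul_notMem hN] with n hn
  refine Measure.measure_prod_null_of_ae_null
    ((measurable_segmentDiff.comp measurable_prodMk_left) hNm) (ae_of_all _ fun s => ?_)
  have h1 : ∀ᵐ t : ℝ, (t - s) • (n : E3) ∉ N :=
    (measurePreserving_sub_right volume s).quasiMeasurePreserving.ae hn
  have h2 : ∀ᵐ t ∂θ, (t - s) • (n : E3) ∉ N := hθ.ae_le h1
  rw [ae_iff] at h2
  refine measure_mono_null (fun t ht => ?_) h2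
  simpa using ht

/-- The density of `segmentDiffMeasure`. -/
noncomputable def segmentDiffKernel (θ : Measure ℝ) (y : E3) : ℝ :=
  ((segmentDiffMeasure θ).rnDeriv volume y).toReal

theorem integrable_segmentDiffKernel (θ : Measure ℝ) [IsFiniteMeasure θ] :
    Integrable (segmentDiffKernel θ) :=
  Measure.integrable_toReal_rnDeriv

theorem integral_segmentDiff {θ : Measure ℝ} [IsFiniteMeasure θ] (hθ : θ ≪ volume)
    {g : E3 → ℝ} (hg : Measurable g) :
    ∫ q, g ((q.2.2 - q.2.1) • (q.1 : E3)) ∂(sphereMeasure.prod (θ.prod θ)) =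
      ∫ y, segmentDiffKernel θ y * g y := by
  have h1 := integral_rnDeriv_smul (segmentDiffMeasure_absolutelyContinuous hθ) (f := g)
  simp only [smul_eq_mul] at h1
  change _ = ∫ y, ((segmentDiffMeasure θ).rnDeriv volume y).toReal * g y
  rw [h1, segmentDiffMeasure,
    integral_map measurable_segmentDiff.aemeasurable hg.aestronglyMeasurable]

/-! ### Integrability of bounded functions. -/

/-- A bounded measurable function supported in a set of finite measure is integrable. -/
theorem integrable_of_bounded_support {α : Type*} [MeasurableSpace α] {μ : Measure α}
    {f : α → ℝ} (hf : Measurable f) {S : Set α} (hS : μ S < ∞) {C : ℝ}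
    (hC : ∀ x, |f x| ≤ C) (h0 : ∀ᵐ x ∂μ, x ∉ S → f x = 0) : Integrable f μ := by
  have h1 : IntegrableOn f S μ := by
    have : IsFiniteMeasure (μ.restrict S) := ⟨by simpa using hS⟩
    exact Integrable.of_bound hf.aestronglyMeasurable C (ae_of_all _ hC)
  exact h1.integrable_of_ae_notMem_eq_zero h0

theorem measurable_integral_right {α β : Type*} [MeasurableSpace α] [MeasurableSpace β]
    {μ : Measure β} [SFinite μ] {f : α → β → ℝ} (hf : Measurable fun p : α × β => f p.1 p.2) :
    Measurable fun x => ∫ y, f x y ∂μ :=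
  (hf.stronglyMeasurable.integral_prod_right').measurable

theorem abs_integral_le_of_bounded {α : Type*} [MeasurableSpace α] {μ : Measure α}
    [IsFiniteMeasure μ] {f : α → ℝ} {C : ℝ} (hC : ∀ x, |f x| ≤ C) :
    |∫ x, f x ∂μ| ≤ C * μ.real univ := by
  simpa using norm_integral_le_of_norm_le_const (μ := μ) (f := f) (ae_of_all _ hC)

theorem norm_add_smul_sphere_le (y : E3) (n : S2) {s : ℝ} (hs : 0 ≤ s) :
    ‖y + s • (n : E3)‖ ≤ ‖y‖ + s ∧ ‖y‖ ≤ ‖y + s • (n : E3)‖ + s := by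
  have h1 : ‖s • (n : E3)‖ = s := by
    rw [norm_smul, Real.norm_of_nonneg hs, norm_eq_of_mem_sphere, mul_one]
  constructor
  · simpa [h1] using norm_add_le y (s • (n : E3))
  · simpa [h1] using norm_sub_le (y + s • (n : E3)) (s • (n : E3))

/-! ### Directional averages and the cost of smearing along rays. -/

/-- The average over directions. -/
noncomputable def dirAvg (A : E3 → S2 → ℝ) (x : E3) : ℝ := ∫ n, A x n ∂sphereMeasure

/-- The average over directions and over a random backward displacement. -/
noncomputable def segAvg (A : E3 → S2 → ℝ) (θ : Measure ℝ) (x : E3) : ℝ :=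
  ∫ q, A (x - q.2 • (q.1 : E3)) q.1 ∂(sphereMeasure.prod θ)

/-- A bounded non-negative function whose increments along each direction are bounded above
linearly. -/
structure IsRaySemiLipschitz (A : E3 → S2 → ℝ) (C : ℝ) : Prop where
  measurable : Measurable fun p : E3 × S2 => A p.1 p.2
  nonneg : ∀ x n, 0 ≤ A x n
  le_const : ∀ x n, A x n ≤ C
  le_add : ∀ x n s, 0 ≤ s → A x n ≤ A (x - s • (n : E3)) n + C * s

theorem measurable_dirAvg {A : E3 → S2 → ℝ} (hA : Measurable fun p : E3 × S2 => A p.1 p.2) :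
    Measurable (dirAvg A) :=
  measurable_integral_right hA

theorem measurable_shift {A : E3 → S2 → ℝ} (hA : Measurable fun p : E3 × S2 => A p.1 p.2) :
    Measurable fun p : E3 × (S2 × ℝ) => A (p.1 - p.2.2 • (p.2.1 : E3)) p.2.1 :=
  hA.comp (f := fun p : E3 × (S2 × ℝ) => (p.1 - p.2.2 • (p.2.1 : E3), p.2.1)) (by fun_prop)

theorem measurable_segAvg {A : E3 → S2 → ℝ} {θ : Measure ℝ} [IsFiniteMeasure θ]
    (hA : Measurable fun p : E3 × S2 => A p.1 p.2) :
    Measurable (segAvg A θ) :=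
  measurable_integral_right (f := fun x (q : S2 × ℝ) => A (x - q.2 • (q.1 : E3)) q.1)
    (measurable_shift hA)

theorem abs_segAvg_le {A : E3 → S2 → ℝ} {θ : Measure ℝ} [IsProbabilityMeasure θ] {C : ℝ}
    (hC : ∀ x n, |A x n| ≤ C) (x : E3) : |segAvg A θ x| ≤ C * sphereMeasure.real univ := by
  have := abs_integral_le_of_bounded (μ := sphereMeasure.prod θ)
    (f := fun q => A (x - q.2 • (q.1 : E3)) q.1) (fun q => hC _ _)
  simpa [segAvg, ← univ_prod_univ, measureReal_prod_prod] using this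

/-- The signed increments nearly cancel: the integral of the translate over the ball is an integral
of `A` over a shifted ball inside the ball of radius `R + δ`, so only `C` times the volume of the
shell remains. -/
theorem integral_ball_shift_le {A : E3 → S2 → ℝ} {C : ℝ} (hA : IsRaySemiLipschitz A C)
    (n : S2) {R δ s : ℝ} (hs : 0 ≤ s) (hsδ : s ≤ δ) :
    ∫ x in closedBall 0 R, (2 * (C * δ) - (A x n - A (x - s • (n : E3)) n)) ≤
      2 * (C * δ) * volume.real (closedBall (0 : E3) R) +
        C * (volume.real (closedBall (0 : E3) (R + δ)) - volume.real (closedBall (0 : E3) R)) := by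
  have hmn : Measurable fun x => A x n := hA.measurable.comp measurable_prodMk_right
  have hb : ∀ x n, |A x n| ≤ C := fun x n => by
    rw [abs_of_nonneg (hA.nonneg x n)]; exact hA.le_const x n
  have fin : ∀ r : ℝ, volume (closedBall (0 : E3) r) < ∞ := fun r => measure_closedBall_lt_top
  have hint : ∀ r, IntegrableOn (fun x => A x n) (closedBall 0 r) := fun r => by
    have : IsFiniteMeasure ((volume : Measure E3).restrict (closedBall 0 r)) :=
      ⟨by simpa using fin r⟩
    exact Integrable.of_bound hmn.aestronglyMeasurable C (ae_of_all _ fun x => hb x n)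
  have hint2 : IntegrableOn (fun x => A (x - s • (n : E3)) n) (closedBall 0 R) := by
    have : IsFiniteMeasure ((volume : Measure E3).restrict (closedBall 0 R)) :=
      ⟨by simpa using fin R⟩
    exact Integrable.of_bound (hmn.comp (measurable_id.sub_const _)).aestronglyMeasurable C
      (ae_of_all _ fun x => hb _ n)
  have hsub : closedBall (0 : E3) R ⊆ closedBall 0 (R + δ) :=
    closedBall_subset_closedBall (by linarith)
  have e1 : ∫ x in closedBall 0 R, A (x - s • (n : E3)) n ≤
      ∫ x in closedBall 0 (R + δ), A x n := by
    rw [← integral_indicator measurableSet_closedBall,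
      ← integral_indicator measurableSet_closedBall,
      ← integral_add_right_eq_self _ (s • (n : E3))]
    refine integral_mono ?_ ((hint _).integrable_indicator measurableSet_closedBall) fun y => ?_
    · exact (hint2.integrable_indicator measurableSet_closedBall).comp_add_right (s • (n : E3))
    · by_cases h : y + s • (n : E3) ∈ closedBall (0 : E3) R
      · have h' : y ∈ closedBall (0 : E3) (R + δ) := by
          rw [mem_closedBall_zero_iff] at h ⊢
          have := (norm_add_smul_sphere_le y n hs).2
          linarith
        simp only [indicator_of_mem h, indicator_of_mem h', add_sub_cancel_right, le_refl]
      · rw [indicator_of_notMem h]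
        exact indicator_nonneg (fun x _ => hA.nonneg x n) y
  have e2 : (∫ x in closedBall 0 (R + δ), A x n) - ∫ x in closedBall 0 R, A x n ≤
      C * (volume.real (closedBall (0 : E3) (R + δ)) - volume.real (closedBall (0 : E3) R)) := by
    rw [← setIntegral_sdiff measurableSet_closedBall (hint _) hsub,
      ← measureReal_sdiff hsub measurableSet_closedBall (fin _).ne]
    have h := setIntegral_mono_on (s := closedBall (0 : E3) (R + δ) \ closedBall 0 R)
      ((hint _).mono_set sdiff_subset)
      (integrableOn_const (C := C) ((measure_mono sdiff_subset).trans_lt (fin (R + δ))).ne)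
      (measurableSet_closedBall.diff measurableSet_closedBall) fun x _ => hA.le_const x n
    simpa [mul_comm] using h
  have e3 : ∫ x in closedBall 0 R, (2 * (C * δ) - (A x n - A (x - s • (n : E3)) n)) =
      2 * (C * δ) * volume.real (closedBall (0 : E3) R) - ((∫ x in closedBall 0 R, A x n) -
        ∫ x in closedBall 0 R, A (x - s • (n : E3)) n) := by
    rw [integral_sub (f := fun _ => 2 * (C * δ)) (g := fun x => A x n - A (x - s • (n : E3)) n)
      (integrableOn_const (fin R).ne).integrable ((hint R).sub hint2),
      integral_sub (hint R) hint2]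
    simp [mul_comm]
  rw [e3]
  linarith

/-- If `d ≤ a` and `a ≥ 0` then `|d| ≤ 2 a - d`. With `d` the increment along the ray and `a = C δ`,
the right side is signed, so Fubini and the cancellation under translation apply. -/
theorem integral_abs_dirAvg_sub_segAvg_le {A : E3 → S2 → ℝ} {C : ℝ} (hA : IsRaySemiLipschitz A C)
    {θ : Measure ℝ} [IsProbabilityMeasure θ] {R δ : ℝ} (hθ : ∀ᵐ s ∂θ, s ∈ Ioc 0 δ) :
    ∫ x in closedBall 0 R, |dirAvg A x - segAvg A θ x| ≤
      sphereMeasure.real univ * (2 * (C * δ) * volume.real (closedBall (0 : E3) R) +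
        C * (volume.real (closedBall (0 : E3) (R + δ)) -
          volume.real (closedBall (0 : E3) R))) := by
  have hb : ∀ x n, |A x n| ≤ C := fun x n => by
    rw [abs_of_nonneg (hA.nonneg x n)]; exact hA.le_const x n
  have hC0 : 0 ≤ C := (hA.nonneg 0 ⟨EuclideanSpace.single 0 1, by simp⟩).trans (hA.le_const _ _)
  have hfinB : IsFiniteMeasure ((volume : Measure E3).restrict (closedBall 0 R)) :=
    ⟨by rw [Measure.restrict_apply_univ]; exact measure_closedBall_lt_top⟩
  have hms := measurable_shift hA.measurable
  have hm1 : Measurable fun p : E3 × (S2 × ℝ) => A p.1 p.2.1 :=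
    hA.measurable.comp (f := fun p : E3 × (S2 × ℝ) => (p.1, p.2.1)) (by fun_prop)
  set ρ := sphereMeasure.prod θ with hρ
  have hρθ : ∀ᵐ q ∂ρ, q.2 ∈ Ioc 0 δ := Measure.quasiMeasurePreserving_snd.ae hθ
  set G : E3 → S2 × ℝ → ℝ := fun x q =>
    2 * (C * δ) - (A x q.1 - A (x - q.2 • (q.1 : E3)) q.1) with hG
  have hGm : Measurable fun p : E3 × (S2 × ℝ) => G p.1 p.2 :=
    measurable_const.sub (hm1.sub hms)
  have hGb : ∀ x q, |G x q| ≤ 2 * (C * |δ|) + 2 * C := fun x q => by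
    have h1 := hb x q.1
    have h2 := hb (x - q.2 • (q.1 : E3)) q.1
    have h3 : |C * δ| = C * |δ| := by rw [abs_mul, abs_of_nonneg hC0]
    have h4 := abs_le.1 h3.le
    rw [abs_le] at *
    simp only [hG]
    constructor <;> linarith
  have hGi : ∀ x, Integrable (G x) ρ := fun x =>
    Integrable.of_bound (hGm.comp measurable_prodMk_left).aestronglyMeasurable _
      (ae_of_all _ fun q => hGb x q)
  have hpt : ∀ x, |dirAvg A x - segAvg A θ x| ≤ ∫ q, G x q ∂ρ := fun x => by
    have h1 : dirAvg A x = ∫ q, A x q.1 ∂ρ := by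
      rw [hρ, integral_fun_fst]; simp [dirAvg]
    have i1 : Integrable (fun q : S2 × ℝ => A x q.1) ρ :=
      Integrable.of_bound (hm1.comp measurable_prodMk_left).aestronglyMeasurable C
        (ae_of_all _ fun q => hb x _)
    have i2 : Integrable (fun q : S2 × ℝ => A (x - q.2 • (q.1 : E3)) q.1) ρ :=
      Integrable.of_bound (hms.comp measurable_prodMk_left).aestronglyMeasurable C
        (ae_of_all _ fun q => hb _ _)
    rw [h1, segAvg, ← integral_sub i1 i2]
    refine (abs_integral_le_integral_abs).trans (integral_mono_ae (i1.sub i2).abs (hGi x) ?_)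
    filter_upwards [hρθ] with q hq
    have h := hA.le_add x q.1 q.2 hq.1.le
    have h' : C * q.2 ≤ C * δ := mul_le_mul_of_nonneg_left hq.2 hC0
    have h'' : 0 ≤ C * q.2 := mul_nonneg hC0 hq.1.le
    simp only [hG]
    rw [abs_le]
    constructor <;> linarith
  have hGprod : Integrable (Function.uncurry G)
      (((volume : Measure E3).restrict (closedBall 0 R)).prod ρ) :=
    Integrable.of_bound hGm.aestronglyMeasurable _ (ae_of_all _ fun p => hGb p.1 p.2)
  calc ∫ x in closedBall 0 R, |dirAvg A x - segAvg A θ x|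
      ≤ ∫ x in closedBall 0 R, (∫ q, G x q ∂ρ) := by
        refine integral_mono ?_ hGprod.integral_prod_left hpt
        refine hGprod.integral_prod_left.mono' ?_ (ae_of_all _ fun x => ?_)
        · exact ((measurable_dirAvg hA.measurable).sub
            (measurable_segAvg hA.measurable)).abs.aestronglyMeasurable
        · simpa using hpt x
    _ = ∫ q, (∫ x in closedBall 0 R, G x q) ∂ρ := integral_integral_swap hGprod
    _ ≤ ∫ _q, (2 * (C * δ) * volume.real (closedBall (0 : E3) R) +
        C * (volume.real (closedBall (0 : E3) (R + δ)) -
          volume.real (closedBall (0 : E3) R))) ∂ρ := by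
        refine integral_mono_ae hGprod.integral_prod_right (integrable_const _) ?_
        filter_upwards [hρθ] with q hq
        exact integral_ball_shift_le hA q.1 hq.1.le hq.2
    _ = _ := by
        simp [hρ, ← univ_prod_univ, measureReal_prod_prod]

/-! ### The duality argument for smeared averages. -/

/-- The quadratic form `∫∫ v(z) k(y) v(z + y) dy dz` of the kernel `segmentDiffKernel`. -/
noncomputable def segmentForm (θ : Measure ℝ) (v : E3 → ℝ) : ℝ :=
  ∫ z, v z * ∫ y, segmentDiffKernel θ y * v (z + y)

theorem integrable_translates {θ : Measure ℝ} [IsProbabilityMeasure θ] {v : E3 → ℝ} {K R : ℝ}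
    (hv : Measurable v) (hK : ∀ x, |v x| ≤ K) (h0 : ∀ x, x ∉ closedBall (0 : E3) R → v x = 0) :
    Integrable (fun p : E3 × (S2 × ℝ × ℝ) =>
      v p.1 * v (p.1 + (p.2.2.2 - p.2.2.1) • (p.2.1 : E3)))
      (volume.prod (sphereMeasure.prod (θ.prod θ))) := by
  refine integrable_of_bounded_support (S := closedBall (0 : E3) R ×ˢ univ) (C := K * K) ?_ ?_ ?_ ?_
  · exact (hv.comp measurable_fst).mul (hv.comp (by fun_prop))
  · rw [Measure.prod_prod]
    exact ENNReal.mul_lt_top measure_closedBall_lt_top (measure_lt_top _ _)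
  · intro p
    rw [abs_mul]
    exact mul_le_mul (hK _) (hK _) (abs_nonneg _) ((abs_nonneg _).trans (hK 0))
  · refine ae_of_all _ fun p hp => ?_
    rw [h0 p.1 (fun h => hp ⟨h, mem_univ _⟩), zero_mul]

/-- Write the square as a double integral over `s` and `t`, and translate `y` by `s n`: only the
difference `(t - s) n` remains, and its law has density `segmentDiffKernel`. -/
theorem integral_segment_sq {θ : Measure ℝ} [IsProbabilityMeasure θ] (hθ : θ ≪ volume)
    {δ : ℝ} (hδ : ∀ᵐ s ∂θ, s ∈ Ioc 0 δ) {v : E3 → ℝ} {K R : ℝ}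
    (hv : Measurable v) (hK : ∀ x, |v x| ≤ K) (h0 : ∀ x, x ∉ closedBall (0 : E3) R → v x = 0) :
    ∫ y, (∫ n, (∫ s, v (y + s • (n : E3)) ∂θ) ^ 2 ∂sphereMeasure) = segmentForm θ v := by
  have hK0 : 0 ≤ K := (abs_nonneg _).trans (hK 0)
  have hm : Measurable fun p : E3 × (S2 × ℝ × ℝ) =>
      v (p.1 + p.2.2.1 • (p.2.1 : E3)) * v (p.1 + p.2.2.2 • (p.2.1 : E3)) :=
    (hv.comp (by fun_prop)).mul (hv.comp (by fun_prop))
  have hb : ∀ a b, |v a * v b| ≤ K * K := fun a b => by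
    rw [abs_mul]
    exact mul_le_mul (hK _) (hK _) (abs_nonneg _) hK0
  have hmem : ∀ᵐ p : E3 × (S2 × ℝ × ℝ) ∂(volume.prod (sphereMeasure.prod (θ.prod θ))),
      p.2.2.1 ∈ Ioc 0 δ :=
    (Measure.quasiMeasurePreserving_snd.ae (Measure.quasiMeasurePreserving_snd.ae
      (Measure.quasiMeasurePreserving_fst.ae hδ)))
  have hi : Integrable (Function.uncurry fun (y : E3) (p : S2 × ℝ × ℝ) =>
      v (y + p.2.1 • (p.1 : E3)) * v (y + p.2.2 • (p.1 : E3)))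
      (volume.prod (sphereMeasure.prod (θ.prod θ))) := by
    refine integrable_of_bounded_support (S := closedBall (0 : E3) (R + δ) ×ˢ univ)
      (C := K * K) hm ?_ (fun p => hb _ _) ?_
    · rw [Measure.prod_prod]
      exact ENNReal.mul_lt_top measure_closedBall_lt_top (measure_lt_top _ _)
    · filter_upwards [hmem] with p hp hp'
      have : v (p.1 + p.2.2.1 • (p.2.1 : E3)) = 0 := by
        refine h0 _ fun h => hp' ⟨?_, mem_univ _⟩
        rw [mem_closedBall_zero_iff] at h ⊢
        have := (norm_add_smul_sphere_le p.1 p.2.1 hp.1.le).2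
        linarith [hp.2]
      simp [Function.uncurry, this]
  have hsq : ∀ (y : E3) (n : S2), (∫ s, v (y + s • (n : E3)) ∂θ) ^ 2 =
      ∫ p : ℝ × ℝ, v (y + p.1 • (n : E3)) * v (y + p.2 • (n : E3)) ∂(θ.prod θ) := fun y n => by
    rw [sq]
    exact (integral_prod_mul (fun s => v (y + s • (n : E3))) fun s => v (y + s • (n : E3))).symm
  have hinner : ∀ y : E3, ∫ n, (∫ s, v (y + s • (n : E3)) ∂θ) ^ 2 ∂sphereMeasure =
      ∫ p : S2 × ℝ × ℝ, v (y + p.2.1 • (p.1 : E3)) * v (y + p.2.2 • (p.1 : E3))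
        ∂(sphereMeasure.prod (θ.prod θ)) := fun y => by
    rw [integral_prod]
    · simp only [hsq]
    · exact Integrable.of_bound (hm.comp measurable_prodMk_left).aestronglyMeasurable (K * K)
        (ae_of_all _ fun p => hb _ _)
  have hform : ∀ z : E3, ∫ y, segmentDiffKernel θ y * v (z + y) =
      ∫ p : S2 × ℝ × ℝ, v (z + (p.2.2 - p.2.1) • (p.1 : E3))
        ∂(sphereMeasure.prod (θ.prod θ)) := fun z =>
    (integral_segmentDiff hθ (g := fun y => v (z + y)) (hv.comp (measurable_const_add z))).symm
  simp only [hinner, segmentForm, hform]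
  rw [integral_integral_swap hi]
  simp only [← integral_const_mul]
  have hsw := integral_integral_swap (f := fun (z : E3) (p : S2 × ℝ × ℝ) =>
    v z * v (z + (p.2.2 - p.2.1) • (p.1 : E3))) (integrable_translates (θ := θ) hv hK h0)
  rw [hsw]
  refine integral_congr_ae (ae_of_all _ fun p => ?_)
  simp only
  rw [← integral_add_right_eq_self (fun z => v z * v (z + (p.2.2 - p.2.1) • (p.1 : E3)))
    (p.2.1 • (p.1 : E3))]
  refine integral_congr_ae (ae_of_all _ fun y => ?_)
  simp only
  congr 2
  module

/-- Testing `segAvg A θ` against its own truncation `v` and moving the translation onto `v` gives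
`∫∫ A V`, where `V` averages `v` forward along the ray. Young's inequality with parameter `t`
separates `A` from `V`, and the `L²` norm squared of `V` is the form. -/
theorem integral_sq_segAvg_le {θ : Measure ℝ} [IsProbabilityMeasure θ] (hθ : θ ≪ volume)
    {δ : ℝ} (hδ : ∀ᵐ s ∂θ, s ∈ Ioc 0 δ) {A : E3 → S2 → ℝ} {C : ℝ}
    (hA : Measurable fun p : E3 × S2 => A p.1 p.2) (hC : ∀ x n, |A x n| ≤ C) (R : ℝ)
    {t : ℝ} (ht : 0 < t) :
    ∫ x in closedBall 0 R, segAvg A θ x ^ 2 ≤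
      t * C ^ 2 * sphereMeasure.real univ * volume.real (closedBall (0 : E3) (R + δ)) +
        1 / (4 * t) * segmentForm θ ((closedBall 0 R).indicator (segAvg A θ)) := by
  have hC0 : 0 ≤ C := (abs_nonneg _).trans (hC 0 ⟨EuclideanSpace.single 0 1, by simp⟩)
  set v := (closedBall (0 : E3) R).indicator (segAvg A θ) with hvdef
  set B := closedBall (0 : E3) (R + δ) with hB
  set K := C * sphereMeasure.real univ with hKdef
  have hK0 : 0 ≤ K := mul_nonneg hC0 measureReal_nonneg
  have hv : Measurable v := (measurable_segAvg hA).indicator measurableSet_closedBall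
  have hK : ∀ x, |v x| ≤ K := fun x => by
    by_cases hx : x ∈ closedBall (0 : E3) R
    · rw [hvdef, indicator_of_mem hx]; exact abs_segAvg_le hC x
    · rw [hvdef, indicator_of_notMem hx, abs_zero]; exact hK0
  have h0 : ∀ x, x ∉ closedBall (0 : E3) R → v x = 0 := fun x hx => indicator_of_notMem hx _
  have hBfin : volume B < ∞ := measure_closedBall_lt_top
  set V : E3 → S2 → ℝ := fun y n => ∫ s, v (y + s • (n : E3)) ∂θ with hV
  have hVm : Measurable fun p : E3 × S2 => V p.1 p.2 :=
    measurable_integral_right (f := fun (p : E3 × S2) s => v (p.1 + s • (p.2 : E3)))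
      (hv.comp (by fun_prop))
  have hVK : ∀ y n, |V y n| ≤ K := fun y n => by
    simpa using abs_integral_le_of_bounded (μ := θ) (f := fun s => v (y + s • (n : E3)))
      fun s => hK _
  -- `V` lives on the enlarged ball, which makes the `A²` part of Young's inequality integrable.
  have hV0 : ∀ y n, y ∉ B → V y n = 0 := fun y n hy => by
    refine integral_eq_zero_of_ae ?_
    filter_upwards [hδ] with s hs
    refine h0 _ fun h => hy ?_
    rw [hB, mem_closedBall_zero_iff]
    rw [mem_closedBall_zero_iff] at h
    have := (norm_add_smul_sphere_le y n hs.1.le).2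
    linarith [hs.2]
  have hprodfin : (volume.prod sphereMeasure) (B ×ˢ (univ : Set S2)) < ∞ := by
    rw [Measure.prod_prod]; exact ENNReal.mul_lt_top hBfin (measure_lt_top _ _)
  have iAV : Integrable (fun p : E3 × S2 => A p.1 p.2 * V p.1 p.2)
      (volume.prod sphereMeasure) := by
    refine integrable_of_bounded_support (C := C * K) (hA.mul hVm) hprodfin (fun p => ?_)
      (ae_of_all _ fun p hp => ?_)
    · rw [abs_mul]; exact mul_le_mul (hC _ _) (hVK _ _) (abs_nonneg _) hC0
    · rw [hV0 _ _ fun h => hp ⟨h, mem_univ _⟩, mul_zero]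
  have iVV : Integrable (fun p : E3 × S2 => V p.1 p.2 ^ 2) (volume.prod sphereMeasure) := by
    refine integrable_of_bounded_support (C := K ^ 2) (hVm.pow_const 2) hprodfin (fun p => ?_)
      (ae_of_all _ fun p hp => ?_)
    · rw [abs_pow]; exact pow_le_pow_left₀ (abs_nonneg _) (hVK _ _) 2
    · rw [hV0 _ _ fun h => hp ⟨h, mem_univ _⟩]; simp
  have iB : Integrable ((B ×ˢ (univ : Set S2)).indicator fun _ : E3 × S2 => t * C ^ 2)
      (volume.prod sphereMeasure) :=
    (integrable_indicator_iff (measurableSet_closedBall.prod .univ)).2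
      (integrableOn_const hprodfin.ne)
  have iShift : Integrable (Function.uncurry fun (x : E3) (q : S2 × ℝ) =>
      v x * A (x - q.2 • (q.1 : E3)) q.1) (volume.prod (sphereMeasure.prod θ)) := by
    refine integrable_of_bounded_support (S := closedBall (0 : E3) R ×ˢ univ) (C := K * C)
      ((hv.comp measurable_fst).mul (measurable_shift hA)) ?_ (fun p => ?_)
      (ae_of_all _ fun p hp => ?_)
    · rw [Measure.prod_prod]
      exact ENNReal.mul_lt_top measure_closedBall_lt_top (measure_lt_top _ _)
    · simp only [Function.uncurry, abs_mul]
      exact mul_le_mul (hK _) (hC _ _) (abs_nonneg _) hK0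
    · simp only [Function.uncurry]
      rw [h0 p.1 fun h => hp ⟨h, mem_univ _⟩, zero_mul]
  have iUnshift : Integrable (fun p : (S2 × ℝ) × E3 =>
      v (p.2 + p.1.2 • (p.1.1 : E3)) * A p.2 p.1.1) ((sphereMeasure.prod θ).prod volume) := by
    refine integrable_of_bounded_support (S := univ ×ˢ B) (C := K * C) ?_ ?_ (fun p => ?_) ?_
    · exact (hv.comp (by fun_prop)).mul
        (hA.comp (f := fun p : (S2 × ℝ) × E3 => (p.2, p.1.1)) (by fun_prop))
    · rw [Measure.prod_prod]
      exact ENNReal.mul_lt_top (measure_lt_top _ _) hBfin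
    · rw [abs_mul]
      exact mul_le_mul (hK _) (hC _ _) (abs_nonneg _) hK0
    · filter_upwards [Measure.quasiMeasurePreserving_fst.ae
        (Measure.quasiMeasurePreserving_snd.ae hδ)] with p hs hp
      have : v (p.2 + p.1.2 • (p.1.1 : E3)) = 0 := by
        refine h0 _ fun h => hp ⟨mem_univ _, ?_⟩
        rw [hB, mem_closedBall_zero_iff]
        rw [mem_closedBall_zero_iff] at h
        have := (norm_add_smul_sphere_le p.2 p.1.1 hs.1.le).2
        linarith [hs.2]
      rw [this, zero_mul]
  have e1 : ∫ x in closedBall 0 R, segAvg A θ x ^ 2 =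
      ∫ y, (∫ n, A y n * V y n ∂sphereMeasure) := by
    calc ∫ x in closedBall 0 R, segAvg A θ x ^ 2
        = ∫ x, (∫ q, v x * A (x - q.2 • (q.1 : E3)) q.1 ∂(sphereMeasure.prod θ)) := by
          rw [← integral_indicator measurableSet_closedBall]
          refine integral_congr_ae (ae_of_all _ fun x => ?_)
          simp only
          rw [integral_const_mul]
          by_cases hx : x ∈ closedBall (0 : E3) R
          · rw [hvdef, indicator_of_mem hx, indicator_of_mem hx, sq]; rfl
          · rw [hvdef, indicator_of_notMem hx, indicator_of_notMem hx, zero_mul]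
      _ = ∫ q, (∫ x, v x * A (x - q.2 • (q.1 : E3)) q.1) ∂(sphereMeasure.prod θ) :=
          integral_integral_swap iShift
      _ = ∫ q, (∫ y, v (y + q.2 • (q.1 : E3)) * A y q.1) ∂(sphereMeasure.prod θ) := by
          refine integral_congr_ae (ae_of_all _ fun q => ?_)
          simp only
          rw [← integral_add_right_eq_self (fun x => v x * A (x - q.2 • (q.1 : E3)) q.1)
            (q.2 • (q.1 : E3))]
          simp only [add_sub_cancel_right]
      _ = ∫ y, (∫ q, v (y + q.2 • (q.1 : E3)) * A y q.1 ∂(sphereMeasure.prod θ)) :=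
          integral_integral_swap (f := fun (q : S2 × ℝ) (y : E3) =>
            v (y + q.2 • (q.1 : E3)) * A y q.1) iUnshift
      _ = _ := by
          refine integral_congr_ae (ae_of_all _ fun y => ?_)
          simp only
          rw [integral_prod]
          · refine integral_congr_ae (ae_of_all _ fun n => ?_)
            simp only
            rw [integral_mul_const, mul_comm]
          · refine Integrable.of_bound (C := K * C) (Measurable.aestronglyMeasurable ?_)
              (ae_of_all _ fun q => ?_)
            · exact (hv.comp (by fun_prop)).mul
                (hA.comp (f := fun q : S2 × ℝ => (y, q.1)) (by fun_prop))
            · rw [Real.norm_eq_abs, abs_mul]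
              exact mul_le_mul (hK _) (hC _ _) (abs_nonneg _) hK0
  have e2 : ∫ p, A p.1 p.2 * V p.1 p.2 ∂(volume.prod sphereMeasure) ≤
      ∫ p, ((B ×ˢ (univ : Set S2)).indicator (fun _ : E3 × S2 => t * C ^ 2) p +
        1 / (4 * t) * V p.1 p.2 ^ 2) ∂(volume.prod sphereMeasure) := by
    refine integral_mono iAV (iB.add (iVV.const_mul _)) fun p => ?_
    by_cases hp : p ∈ B ×ˢ (univ : Set S2)
    · simp only [indicator_of_mem hp]
      have h1 : A p.1 p.2 ^ 2 ≤ C ^ 2 := sq_le_sq' (abs_le.1 (hC _ _)).1 (abs_le.1 (hC _ _)).2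
      have h2 : t * A p.1 p.2 ^ 2 ≤ t * C ^ 2 := mul_le_mul_of_nonneg_left h1 ht.le
      have h3 : t * A p.1 p.2 ^ 2 + 1 / (4 * t) * V p.1 p.2 ^ 2 - A p.1 p.2 * V p.1 p.2 =
          t * (A p.1 p.2 - 1 / (2 * t) * V p.1 p.2) ^ 2 := by
        field_simp; ring
      have h4 : 0 ≤ t * (A p.1 p.2 - 1 / (2 * t) * V p.1 p.2) ^ 2 := by positivity
      linarith
    · simp only [indicator_of_notMem hp, hV0 _ p.2 fun h => hp ⟨h, mem_univ _⟩]
      simp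
  rw [e1, ← integral_prod _ iAV]
  refine e2.trans (le_of_eq ?_)
  rw [integral_add iB (iVV.const_mul _), integral_const_mul,
    integral_indicator_const _ (measurableSet_closedBall.prod .univ), measureReal_prod_prod,
    integral_prod _ iVV]
  have h5 := integral_segment_sq hθ hδ hv hK h0
  rw [← h5]
  simp only [hV, smul_eq_mul]
  ring

/-! ### Weak convergence makes the quadratic form small. -/

theorem abs_integral_le_of_abs_le {α : Type*} [MeasurableSpace α] {μ : Measure α} {f g : α → ℝ}
    (hg : Integrable g μ) (h : ∀ x, |f x| ≤ g x) : |∫ x, f x ∂μ| ≤ ∫ x, g x ∂μ :=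
  norm_integral_le_of_norm_le (f := f) hg (ae_of_all _ h)

/-- The kernel is approximated in `L¹` by a continuous compactly supported `k'`. By uniform
continuity and compactness of the ball, the translates of `k'` are represented up to `η` by finitely
many, so weak convergence against finitely many test functions bounds the convolution uniformly on
the ball. -/
theorem eventually_segmentForm_le {ι : Type*} {F : Filter ι} {θ : Measure ℝ}
    [IsProbabilityMeasure θ] {v : ι → E3 → ℝ} {K R : ℝ} (hK0 : 0 ≤ K)
    (hv : ∀ i, Measurable (v i)) (hK : ∀ i x, |v i x| ≤ K)
    (h0 : ∀ i x, x ∉ closedBall (0 : E3) R → v i x = 0)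
    (hweak : ∀ g : E3 → ℝ, Continuous g → HasCompactSupport g →
      Tendsto (fun i => ∫ y, g y * v i y) F (𝓝 0)) {ε : ℝ} (hε : 0 < ε) :
    ∀ᶠ i in F, segmentForm θ (v i) ≤ ε := by
  set B := closedBall (0 : E3) R with hB
  have hBfin : volume B < ∞ := measure_closedBall_lt_top
  -- Chosen so that the errors collected at the end add up to exactly `η * M`.
  set M := (K + (1 + K * volume.real B)) * K * volume.real B with hM
  have hM0 : 0 ≤ M := by positivity
  set η := ε / (M + 1) with hη
  have hη0 : 0 < η := by positivity
  have hηM : η * M ≤ ε := by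
    rw [hη, div_mul_eq_mul_div, div_le_iff₀ (by positivity)]
    nlinarith
  obtain ⟨k', hk's, hk'η, hk'c, hk'i⟩ :=
    (integrable_segmentDiffKernel θ).exists_hasCompactSupport_integral_sub_le hη0
  obtain ⟨ρ, hρ0, hρ⟩ := Metric.uniformContinuous_iff.1
    (hk's.uniformContinuous_of_continuous hk'c) η hη0
  obtain ⟨T, -, hTfin, hTcov⟩ := (isCompact_closedBall (0 : E3) R).finite_cover_balls hρ0
  have hgi : ∀ z : E3, Integrable fun y => k' (y - z) := fun z => hk'i.comp_sub_right z
  have hgv : ∀ i (z : E3), Integrable fun y => k' (y - z) * v i y := fun i z =>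
    (hgi z).mul_bdd (hv i).aestronglyMeasurable (ae_of_all _ (hK i))
  have hev : ∀ᶠ i in F, ∀ z ∈ T, |∫ y, k' (y - z) * v i y| ≤ η := by
    refine (eventually_all_finite hTfin).2 fun z _ => ?_
    have h := hweak (fun y => k' (y - z)) (by fun_prop)
      (hk's.comp_homeomorph (Homeomorph.subRight z))
    filter_upwards [h.eventually (Metric.ball_mem_nhds 0 hη0)] with i hi
    rw [Real.dist_0_eq_abs] at hi
    exact hi.le
  filter_upwards [hev] with i hi
  have hball : ∀ z ∈ B, |∫ y, k' (y - z) * v i y| ≤ η + η * (K * volume.real B) := by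
    intro z hz
    obtain ⟨w, hwT, hzw⟩ := mem_iUnion₂.1 (hTcov hz)
    have h1 : |∫ y, (k' (y - z) - k' (y - w)) * v i y| ≤ η * (K * volume.real B) := by
      calc |∫ y, (k' (y - z) - k' (y - w)) * v i y|
          ≤ ∫ y, B.indicator (fun _ => η * K) y := by
            refine abs_integral_le_of_abs_le
              ((integrable_indicator_iff measurableSet_closedBall).2
                (integrableOn_const hBfin.ne)) fun y => ?_
            by_cases hy : y ∈ B
            · rw [indicator_of_mem hy, abs_mul]
              refine mul_le_mul ?_ (hK i y) (abs_nonneg _) hη0.le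
              have := hρ (a := y - z) (b := y - w) (by
                rw [dist_sub_left]; exact hzw)
              rw [Real.dist_eq] at this
              exact this.le
            · rw [indicator_of_notMem hy, h0 i y hy, mul_zero, abs_zero]
        _ = η * (K * volume.real B) := by
            rw [integral_indicator_const _ measurableSet_closedBall, smul_eq_mul]; ring
    have h2 : ∫ y, k' (y - z) * v i y =
        (∫ y, k' (y - w) * v i y) + ∫ y, (k' (y - z) - k' (y - w)) * v i y := by
      simp only [sub_mul]
      rw [integral_sub (hgv i z) (hgv i w)]
      ring
    rw [h2]
    exact (abs_add_le _ _).trans (add_le_add (hi w hwT) h1)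
  have hconv : ∀ z ∈ B, |∫ y, segmentDiffKernel θ y * v i (z + y)| ≤
      η * K + (η + η * (K * volume.real B)) := by
    intro z hz
    have hvz : AEStronglyMeasurable (fun y => v i (z + y)) volume :=
      ((hv i).comp (measurable_const_add z)).aestronglyMeasurable
    have i1 : Integrable fun y => segmentDiffKernel θ y * v i (z + y) :=
      (integrable_segmentDiffKernel θ).mul_bdd hvz (ae_of_all _ fun y => hK i _)
    have i2 : Integrable fun y => k' y * v i (z + y) :=
      hk'i.mul_bdd hvz (ae_of_all _ fun y => hK i _)
    have h1 : |∫ y, (segmentDiffKernel θ y - k' y) * v i (z + y)| ≤ η * K := by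
      calc |∫ y, (segmentDiffKernel θ y - k' y) * v i (z + y)|
          ≤ ∫ y, |segmentDiffKernel θ y - k' y| * K := by
            refine abs_integral_le_of_abs_le
              (((integrable_segmentDiffKernel θ).sub hk'i).abs.mul_const K)
              fun y => ?_
            rw [abs_mul]
            exact mul_le_mul_of_nonneg_left (hK i _) (abs_nonneg _)
        _ ≤ η * K := by
            rw [integral_mul_const]
            exact mul_le_mul_of_nonneg_right hk'η hK0
    have h2 : ∫ y, k' y * v i (z + y) = ∫ y, k' (y - z) * v i y := by
      rw [← integral_add_right_eq_self (fun y => k' (y - z) * v i y) z]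
      simp only [add_sub_cancel_right, add_comm z]
    have h3 : ∫ y, segmentDiffKernel θ y * v i (z + y) =
        (∫ y, (segmentDiffKernel θ y - k' y) * v i (z + y)) + ∫ y, k' y * v i (z + y) := by
      simp only [sub_mul]
      rw [integral_sub i1 i2]
      ring
    rw [h3, h2]
    exact (abs_add_le _ _).trans (add_le_add h1 (hball z hz))
  calc segmentForm θ (v i)
      ≤ |segmentForm θ (v i)| := le_abs_self _
    _ ≤ ∫ z, B.indicator (fun _ => K * (η * K + (η + η * (K * volume.real B)))) z := by
        refine abs_integral_le_of_abs_le
          ((integrable_indicator_iff measurableSet_closedBall).2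
            (integrableOn_const hBfin.ne)) fun z => ?_
        by_cases hz : z ∈ B
        · rw [indicator_of_mem hz, abs_mul]
          exact mul_le_mul (hK i z) (hconv z hz) (abs_nonneg _) hK0
        · rw [indicator_of_notMem hz, h0 i z hz, zero_mul, abs_zero]
    _ = η * M := by
        rw [integral_indicator_const _ measurableSet_closedBall, smul_eq_mul, hM]; ring
    _ ≤ ε := hηM

theorem exists_tendsto_of_bounded {ι : Type*} (U : Ultrafilter ι) {m : ι → ℝ} {C : ℝ}
    (hm : ∀ i, |m i| ≤ C) : ∃ a, Tendsto m U (𝓝 a) := by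
  obtain ⟨a, -, ha⟩ := (isCompact_Icc (a := -C) (b := C)).ultrafilter_le_nhds (U.map m)
    (by
      rw [le_principal_iff]
      exact Ultrafilter.mem_map.2 (univ_mem' fun i => abs_le.1 (hm i)))
  exact ⟨a, ha⟩

/-- Bounded real sequences converge along an ultrafilter, so no weakly convergent subsequence need
be extracted: pairs taken along `U ×ˢ U` have differences tending weakly to zero. -/
theorem tendsto_integral_sub_ultrafilter {ι : Type*} (U : Ultrafilter ι) {v : ι → E3 → ℝ} {K : ℝ}
    (hv : ∀ i, Measurable (v i)) (hK : ∀ i x, |v i x| ≤ K) {g : E3 → ℝ} (hg : Integrable g) :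
    Tendsto (fun p : ι × ι => ∫ y, g y * (v p.1 y - v p.2 y)) ((U : Filter ι) ×ˢ (U : Filter ι))
      (𝓝 0) := by
  have hi : ∀ i, Integrable fun y => g y * v i y := fun i =>
    hg.mul_bdd (hv i).aestronglyMeasurable (ae_of_all _ (hK i))
  obtain ⟨a, ha⟩ := exists_tendsto_of_bounded U (m := fun i => ∫ y, g y * v i y)
    (C := ∫ y, |g y| * K) fun i => by
      refine abs_integral_le_of_abs_le (hg.abs.mul_const K) fun y => ?_
      rw [abs_mul]
      exact mul_le_mul_of_nonneg_left (hK i _) (abs_nonneg _)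
  have h := (ha.comp (tendsto_fst (g := (U : Filter ι)))).sub
    (ha.comp (tendsto_snd (f := (U : Filter ι))))
  rw [sub_self] at h
  refine h.congr fun p => ?_
  simp only [Function.comp, mul_sub]
  rw [integral_sub (hi _) (hi _)]

/-! ### The Cauchy property along ultrafilters. -/

/-- The volume of a ball is a cubic polynomial in the radius, so the smearing error is continuous in
`δ` and vanishes at `δ = 0`. -/
theorem exists_segment_length (C R : ℝ) (hR : 0 ≤ R) {ε : ℝ} (hε : 0 < ε) :
    ∃ δ : ℝ, 0 < δ ∧
      C * sphereMeasure.real univ * (sphereMeasure.real univ *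
        (2 * (C * δ) * volume.real (closedBall (0 : E3) R) +
        C * (volume.real (closedBall (0 : E3) (R + δ)) -
          volume.real (closedBall (0 : E3) R)))) ≤ ε := by
  set b := volume.real (ball (0 : E3) 1)
  have hvol : ∀ r : ℝ, 0 ≤ r → volume.real (closedBall (0 : E3) r) = r ^ 3 * b := fun r hr => by
    rw [Measure.addHaar_real_closedBall _ _ hr]; simp [b]
  have hcont : Continuous fun δ : ℝ => C * sphereMeasure.real univ * (sphereMeasure.real univ *
        (2 * (C * δ) * (R ^ 3 * b) + C * ((R + δ) ^ 3 * b - R ^ 3 * b))) := by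
    fun_prop
  have ht := hcont.tendsto 0
  simp only [mul_zero, zero_mul, add_zero, sub_self] at ht
  have h1 := (ht.mono_left (nhdsWithin_le_nhds (s := Ioi (0 : ℝ)))).eventually (Iic_mem_nhds hε)
  obtain ⟨δ, hδ1, hδ0⟩ := (h1.and self_mem_nhdsWithin).exists
  have hδ0 : 0 < δ := hδ0
  refine ⟨δ, hδ0, ?_⟩
  rw [hvol _ hR, hvol _ (by positivity)]
  exact hδ1

/-- The difference splits into two smearing errors, uniformly small once `δ` is fixed, and a
difference of smeared averages, eventually small by duality. -/
theorem eventually_integral_sq_dirAvg_sub_le {ι : Type*} (U : Ultrafilter ι)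
    {A : ι → E3 → S2 → ℝ} {C : ℝ} (hA : ∀ i, IsRaySemiLipschitz (A i) C) {R : ℝ} (hR : 0 ≤ R)
    {ε : ℝ} (hε : 0 < ε) :
    ∀ᶠ p in (U : Filter ι) ×ˢ (U : Filter ι),
      ∫ x in closedBall 0 R, (dirAvg (A p.1) x - dirAvg (A p.2) x) ^ 2 ≤ ε := by
  have hb : ∀ i x n, |A i x n| ≤ C := fun i x n => by
    rw [abs_of_nonneg ((hA i).nonneg x n)]; exact (hA i).le_const x n
  obtain ⟨i₀⟩ : Nonempty ι := U.neBot.nonempty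
  have hC0 : 0 ≤ C := (abs_nonneg _).trans (hb i₀ 0 ⟨EuclideanSpace.single 0 1, by simp⟩)
  set S := sphereMeasure.real univ with hS
  have hS0 : 0 ≤ S := measureReal_nonneg
  -- Three pieces of size `ε / 9`, with the factor 3 from the square of a sum of three terms, give
  -- `ε`.
  obtain ⟨δ, hδ0, hδ⟩ := exists_segment_length C R hR (ε := ε / 9) (by positivity)
  have hIoc : (volume : Measure ℝ) (Ioc 0 δ) ≠ 0 := by simp [hδ0]
  set θ := ProbabilityTheory.cond (volume : Measure ℝ) (Ioc 0 δ) with hθdef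
  have hprob : IsProbabilityMeasure θ :=
    ProbabilityTheory.cond_isProbabilityMeasure_of_finite hIoc (by simp)
  have hθ : θ ≪ volume := ProbabilityTheory.cond_absolutelyContinuous
  have hθδ : ∀ᵐ s ∂θ, s ∈ Ioc 0 δ := ProbabilityTheory.ae_cond_mem measurableSet_Ioc
  have hfinB : IsFiniteMeasure ((volume : Measure E3).restrict (closedBall 0 R)) :=
    ⟨by rw [Measure.restrict_apply_univ]; exact measure_closedBall_lt_top⟩
  have hdm : ∀ i, Measurable (dirAvg (A i)) := fun i => measurable_dirAvg (hA i).measurable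
  have hsm : ∀ i, Measurable (segAvg (A i) θ) := fun i => measurable_segAvg (hA i).measurable
  have hdb : ∀ i x, dirAvg (A i) x ∈ Icc 0 (C * S) := fun i x =>
    ⟨integral_nonneg fun n => (hA i).nonneg x n,
      (le_abs_self _).trans (abs_integral_le_of_bounded (hb i x))⟩
  have hsb : ∀ i x, segAvg (A i) θ x ∈ Icc 0 (C * S) := fun i x =>
    ⟨integral_nonneg fun q => (hA i).nonneg _ _, (le_abs_self _).trans (abs_segAvg_le (hb i) x)⟩
  have hds : ∀ i x, |dirAvg (A i) x - segAvg (A i) θ x| ≤ C * S := fun i x => by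
    have h1 := hdb i x
    have h2 := hsb i x
    rw [abs_le]; constructor <;> linarith [h1.1, h1.2, h2.1, h2.2]
  have hss : ∀ i j x, |segAvg (A i) θ x - segAvg (A j) θ x| ≤ C * S := fun i j x => by
    have h1 := hsb i x
    have h2 := hsb j x
    rw [abs_le]; constructor <;> linarith [h1.1, h1.2, h2.1, h2.2]
  have ids : ∀ i, IntegrableOn (fun x => |dirAvg (A i) x - segAvg (A i) θ x|)
      (closedBall 0 R) := fun i =>
    Integrable.of_bound ((hdm i).sub (hsm i)).abs.aestronglyMeasurable (C * S)
      (ae_of_all _ fun x => by rw [Real.norm_eq_abs, abs_abs]; exact hds i x)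
  have isq : ∀ {f : E3 → ℝ}, Measurable f → (∀ x, |f x| ≤ C * S) →
      IntegrableOn (fun x => f x ^ 2) (closedBall 0 R) := fun hf hfb =>
    Integrable.of_bound (hf.pow_const 2).aestronglyMeasurable ((C * S) ^ 2)
      (ae_of_all _ fun x => by
        rw [Real.norm_eq_abs, abs_pow]; exact pow_le_pow_left₀ (abs_nonneg _) (hfb x) 2)
  have hUW : ∀ i, ∫ x in closedBall 0 R, (dirAvg (A i) x - segAvg (A i) θ x) ^ 2 ≤ ε / 9 :=
    fun i => by
    -- Since the difference is at most `C * S`, its square is at most `C * S` times its absolute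
    -- value: the `L¹` bound becomes an `L²` bound.
    calc ∫ x in closedBall 0 R, (dirAvg (A i) x - segAvg (A i) θ x) ^ 2
        ≤ ∫ x in closedBall 0 R, C * S * |dirAvg (A i) x - segAvg (A i) θ x| := by
          refine integral_mono (isq ((hdm i).sub (hsm i)) (hds i)) ((ids i).const_mul _)
            fun x => ?_
          simp only
          rw [← sq_abs, sq]
          exact mul_le_mul_of_nonneg_right (hds i x) (abs_nonneg _)
      _ ≤ _ := by
          rw [integral_const_mul]
          exact mul_le_mul_of_nonneg_left (integral_abs_dirAvg_sub_segAvg_le (hA i) hθδ)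
            (mul_nonneg hC0 hS0)
      _ ≤ ε / 9 := hδ
  set v : ι → E3 → ℝ := fun i => (closedBall (0 : E3) R).indicator (segAvg (A i) θ) with hvdef
  have hvm : ∀ i, Measurable (v i) := fun i => (hsm i).indicator measurableSet_closedBall
  have hvb : ∀ i x, |v i x| ≤ C * S := fun i x => by
    by_cases hx : x ∈ closedBall (0 : E3) R
    · simp only [hvdef, indicator_of_mem hx]; exact abs_segAvg_le (hb i) x
    · simp only [hvdef, indicator_of_notMem hx, abs_zero]; positivity
  set a := C ^ 2 * S * volume.real (closedBall (0 : E3) (R + δ)) with ha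
  have ha0 : 0 ≤ a := by positivity
  -- Young's parameter: the `A²` term is at most `ε / 18`, and a form of size at most `4 * t * (ε /
  -- 18)` contributes the other `ε / 18`.
  set t := ε / (18 * (a + 1)) with ht
  have ht0 : 0 < t := by positivity
  have hta : t * a ≤ ε / 18 := by
    rw [ht, div_mul_eq_mul_div, div_le_div_iff₀ (by positivity) (by positivity)]
    nlinarith
  have hform := eventually_segmentForm_le (F := (U : Filter ι) ×ˢ (U : Filter ι)) (θ := θ)
    (v := fun p x => v p.1 x - v p.2 x) (K := C * S) (R := R) (mul_nonneg hC0 hS0)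
    (fun p => (hvm _).sub (hvm _))
    (fun p x => by
      by_cases hx : x ∈ closedBall (0 : E3) R
      · simp only [hvdef, indicator_of_mem hx]; exact hss _ _ x
      · simp only [hvdef, indicator_of_notMem hx, sub_zero, abs_zero]; positivity)
    (fun p x hx => by simp only [hvdef, indicator_of_notMem hx, sub_zero])
    (fun g hg hgs => tendsto_integral_sub_ultrafilter U hvm hvb
      (hg.integrable_of_hasCompactSupport hgs)) (ε := 4 * t * (ε / 18)) (by positivity)
  filter_upwards [hform] with p hp
  have hWW : ∫ x in closedBall 0 R, (segAvg (A p.1) θ x - segAvg (A p.2) θ x) ^ 2 ≤ ε / 9 := by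
    have hsub : ∀ x, segAvg (fun x n => A p.1 x n - A p.2 x n) θ x =
        segAvg (A p.1) θ x - segAvg (A p.2) θ x := fun x => by
      have hi : ∀ i, Integrable (fun q : S2 × ℝ => A i (x - q.2 • (q.1 : E3)) q.1)
          (sphereMeasure.prod θ) := fun i =>
        Integrable.of_bound ((measurable_shift (hA i).measurable).comp
          measurable_prodMk_left).aestronglyMeasurable C (ae_of_all _ fun q => hb i _ _)
      exact integral_sub (hi _) (hi _)
    have h := integral_sq_segAvg_le hθ hθδ (A := fun x n => A p.1 x n - A p.2 x n) (C := C)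
      ((hA p.1).measurable.sub (hA p.2).measurable) (fun x n => by
        have h1 := (hA p.1).nonneg x n
        have h2 := (hA p.1).le_const x n
        have h3 := (hA p.2).nonneg x n
        have h4 := (hA p.2).le_const x n
        rw [abs_le]; constructor <;> linarith) R ht0
    have hv' : (closedBall (0 : E3) R).indicator (segAvg (fun x n => A p.1 x n - A p.2 x n) θ) =
        fun x => v p.1 x - v p.2 x := by
      ext x
      by_cases hx : x ∈ closedBall (0 : E3) R
      · simp only [hvdef, indicator_of_mem hx, hsub]
      · simp only [hvdef, indicator_of_notMem hx, sub_zero]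
    rw [hv'] at h
    simp only [hsub] at h
    refine h.trans ?_
    have h5 : 1 / (4 * t) * segmentForm θ (fun x => v p.1 x - v p.2 x) ≤
        1 / (4 * t) * (4 * t * (ε / 18)) := mul_le_mul_of_nonneg_left hp (by positivity)
    have h6 : 1 / (4 * t) * (4 * t * (ε / 18)) = ε / 18 := by field_simp
    have h7 : t * C ^ 2 * S * volume.real (closedBall (0 : E3) (R + δ)) = t * a := by
      rw [ha]; ring
    rw [h7]
    linarith
  have i1 : IntegrableOn (fun x => (dirAvg (A p.1) x - segAvg (A p.1) θ x) ^ 2)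
    (closedBall 0 R) := isq ((hdm p.1).sub (hsm p.1)) (hds p.1)
  have i2 : IntegrableOn (fun x => (segAvg (A p.1) θ x - segAvg (A p.2) θ x) ^ 2)
    (closedBall 0 R) := isq ((hsm p.1).sub (hsm p.2)) (hss p.1 p.2)
  have i3 : IntegrableOn (fun x => (dirAvg (A p.2) x - segAvg (A p.2) θ x) ^ 2)
    (closedBall 0 R) := isq ((hdm p.2).sub (hsm p.2)) (hds p.2)
  have i12 : IntegrableOn (fun x => (dirAvg (A p.1) x - segAvg (A p.1) θ x) ^ 2 +
    (segAvg (A p.1) θ x - segAvg (A p.2) θ x) ^ 2) (closedBall 0 R) := i1.add i2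
  have hle : ∫ x in closedBall 0 R, (dirAvg (A p.1) x - dirAvg (A p.2) x) ^ 2 ≤
      ∫ x in closedBall 0 R, 3 * ((dirAvg (A p.1) x - segAvg (A p.1) θ x) ^ 2 +
        (segAvg (A p.1) θ x - segAvg (A p.2) θ x) ^ 2 +
        (dirAvg (A p.2) x - segAvg (A p.2) θ x) ^ 2) := by
    refine integral_mono (isq ((hdm p.1).sub (hdm p.2)) fun x => ?_)
      ((i12.add i3).const_mul 3) fun x => ?_
    · have h1 := hdb p.1 x
      have h2 := hdb p.2 x
      rw [abs_le]
      constructor <;> linarith [h1.1, h1.2, h2.1, h2.2]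
    · nlinarith [sq_nonneg ((dirAvg (A p.1) x - segAvg (A p.1) θ x) -
          (segAvg (A p.1) θ x - segAvg (A p.2) θ x)),
        sq_nonneg ((dirAvg (A p.1) x - segAvg (A p.1) θ x) +
          (dirAvg (A p.2) x - segAvg (A p.2) θ x)),
        sq_nonneg ((segAvg (A p.1) θ x - segAvg (A p.2) θ x) +
          (dirAvg (A p.2) x - segAvg (A p.2) θ x))]
  refine hle.trans ?_
  rw [integral_const_mul, integral_add i12 i3, integral_add i1 i2]
  linarith [hUW p.1, hUW p.2]

/-! ### From the Cauchy property to compactness in `L²`. -/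

/-- A set is totally bounded when every ultrafilter on it is Cauchy. An ultrafilter on the range is
the image of one on the index set, obtained by refining its pullback. -/
theorem isCompact_closure_range_of_ultrafilter {X : Type*} [PseudoMetricSpace X] [CompleteSpace X]
    {ι : Type*} (u : ι → X)
    (h : ∀ U : Ultrafilter ι, ∀ ε > 0,
      ∀ᶠ p in (U : Filter ι) ×ˢ (U : Filter ι), dist (u p.1) (u p.2) ≤ ε) :
    IsCompact (closure (range u)) := by
  refine TotallyBounded.isCompact_of_isClosed (TotallyBounded.closure ?_) isClosed_closure
  rw [totallyBounded_iff_ultrafilter]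
  intro G hG
  have hne : NeBot (comap u (G : Filter X)) := comap_neBot_iff.2 fun t ht => by
    obtain ⟨x, hxt, i, rfl⟩ := G.neBot.nonempty_of_mem (inter_mem ht (le_principal_iff.1 hG))
    exact ⟨i, hxt⟩
  set V := Ultrafilter.of (comap u (G : Filter X))
  have hV : (V.map u : Filter X) ≤ G :=
    (Filter.map_mono (Ultrafilter.of_le _)).trans map_comap_le
  rw [← Ultrafilter.coe_le_coe.1 hV]
  refine cauchy_map_iff.2 ⟨V.neBot, ?_⟩
  rw [Metric.uniformity_eq_comap_nhds_zero, tendsto_comap_iff, Metric.tendsto_nhds]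
  intro ε hε
  filter_upwards [h V (ε / 2) (by positivity)] with p hp
  simp only [Function.comp, Real.dist_0_eq_abs, abs_of_nonneg dist_nonneg]
  linarith

theorem norm_toLp_two_sq {α : Type*} [MeasurableSpace α] {μ : Measure α} {f : α → ℝ}
    (hf : MemLp f 2 μ) : ‖hf.toLp f‖ ^ 2 = ∫ x, f x ^ 2 ∂μ := by
  rw [← real_inner_self_eq_norm_sq, L2.inner_def]
  refine integral_congr_ae ?_
  filter_upwards [hf.coeFn_toLp] with x hx
  rw [hx, real_inner_self_eq_norm_sq, Real.norm_eq_abs, sq_abs]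

/-- An averaging lemma: averages over directions of functions which are uniformly bounded and
uniformly semi-Lipschitz along rays are compact in `L²`. -/
theorem compactInL2_of_ae_eq_dirAvg {Ω : Set E3}
    (hΩb : Bornology.IsBounded Ω) {u : ℕ → E3 → ℝ}
    {A : ℕ → E3 → S2 → ℝ} {C : ℝ} (hA : ∀ j, IsRaySemiLipschitz (A j) C)
    (hu : ∀ j, u j =ᵐ[volume.restrict Ω] dirAvg (A j)) : CompactInL2 Ω u := by
  obtain ⟨R, hR0, hR⟩ : ∃ R : ℝ, 0 ≤ R ∧ Ω ⊆ closedBall 0 R := by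
    obtain ⟨R, hR⟩ := hΩb.subset_closedBall (0 : E3)
    exact ⟨max R 0, le_max_right _ _, hR.trans (closedBall_subset_closedBall (le_max_left _ _))⟩
  have hfinΩ : IsFiniteMeasure ((volume : Measure E3).restrict Ω) :=
    ⟨by rw [Measure.restrict_apply_univ]; exact hΩb.measure_lt_top⟩
  have hfinB : IsFiniteMeasure ((volume : Measure E3).restrict (closedBall 0 R)) :=
    ⟨by rw [Measure.restrict_apply_univ]; exact measure_closedBall_lt_top⟩
  have hdm : ∀ j, Measurable (dirAvg (A j)) := fun i => measurable_dirAvg (hA i).measurable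
  have hdb : ∀ j x, |dirAvg (A j) x| ≤ C * sphereMeasure.real univ := fun j x =>
    abs_integral_le_of_bounded fun n => by
      rw [abs_of_nonneg ((hA j).nonneg x n)]; exact (hA j).le_const x n
  have hmem : ∀ j, MemLp (u j) 2 (volume.restrict Ω) := fun j =>
    (memLp_congr_ae (hu j)).2
      (MemLp.of_bound (hdm j).aestronglyMeasurable _ (ae_of_all _ (hdb j)))
  refine ⟨hmem, isCompact_closure_range_of_ultrafilter _ fun U ε hε => ?_⟩
  filter_upwards [eventually_integral_sq_dirAvg_sub_le U hA hR0 (ε := ε ^ 2) (by positivity)]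
    with p hp
  have hsq : ∫ x in Ω, (u p.1 x - u p.2 x) ^ 2 ≤ ε ^ 2 := by
    calc ∫ x in Ω, (u p.1 x - u p.2 x) ^ 2
        = ∫ x in Ω, (dirAvg (A p.1) x - dirAvg (A p.2) x) ^ 2 := by
          refine integral_congr_ae ?_
          filter_upwards [hu p.1, hu p.2] with x h1 h2
          rw [h1, h2]
      _ ≤ ∫ x in closedBall 0 R, (dirAvg (A p.1) x - dirAvg (A p.2) x) ^ 2 := by
          refine setIntegral_mono_set ?_ (ae_of_all _ fun x => sq_nonneg _)
            (LE.le.eventuallyLE hR)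
          refine Integrable.of_bound (((hdm _).sub (hdm _)).pow_const 2).aestronglyMeasurable
            ((2 * (C * sphereMeasure.real univ)) ^ 2) (ae_of_all _ fun x => ?_)
          rw [Real.norm_eq_abs, abs_pow]
          refine pow_le_pow_left₀ (abs_nonneg _) ((abs_sub _ _).trans ?_) 2
          linarith [hdb p.1 x, hdb p.2 x]
      _ ≤ ε ^ 2 := hp
  rw [dist_eq_norm, ← MemLp.toLp_sub]
  refine le_of_sq_le_sq ?_ hε.le
  rw [norm_toLp_two_sq]
  exact hsq

/-! ### Measurable representatives of the coefficients. -/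

/-- A non-negative element of `L^∞(X, L¹(ℝ₊))`, extended by zero, has a representative which is
measurable and satisfies the norm bound everywhere. -/
theorem exists_measurable_representative {X : Type*} [MeasurableSpace X] {μ : Measure X}
    [SFinite μ] {s : Set X} (hs : MeasurableSet s) {g : X → ℝ → ℝ} {M : ℝ≥0}
    (hm : AEMeasurable (fun p : X × ℝ => g p.1 p.2) ((μ.restrict s).prod freqMeasure))
    (h0 : ∀ᵐ p ∂((μ.restrict s).prod freqMeasure), 0 ≤ g p.1 p.2)
    (hM : ∀ᵐ x ∂(μ.restrict s), ∫⁻ ν, ‖g x ν‖ₑ ∂freqMeasure ≤ M) :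
    ∃ g' : X → ℝ → ℝ≥0∞, (Measurable fun p : X × ℝ => g' p.1 p.2) ∧
      (∀ x, ∫⁻ ν, g' x ν ∂freqMeasure ≤ M) ∧
      ∀ᵐ p ∂(μ.prod freqMeasure), 0 ≤ s.indicator (fun z => g z p.2) p.1 ∧
        ENNReal.ofReal (s.indicator (fun z => g z p.2) p.1) = g' p.1 p.2 := by
  set G := hm.mk _ with hG
  have hGm : Measurable G := hm.measurable_mk
  have hGe : ∀ᵐ p ∂((μ.restrict s).prod freqMeasure), g p.1 p.2 = G p := hm.ae_eq_mk
  have hGm' : Measurable fun p : X × ℝ => ENNReal.ofReal (G p) := hGm.ennreal_ofReal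
  -- Discarding the points where the bound fails makes it hold everywhere; `T` fills `s` up to a
  -- null set.
  set T : Set X := s ∩ {x | ∫⁻ ν, ENNReal.ofReal (G (x, ν)) ∂freqMeasure ≤ M} with hT
  have hTm : MeasurableSet T := hs.inter
    (measurableSet_le hGm'.lintegral_prod_right' measurable_const)
  have hTae : ∀ᵐ x ∂μ, x ∈ s → x ∈ T := by
    rw [← ae_restrict_iff' hs]
    filter_upwards [hM, Measure.ae_ae_of_ae_prod hGe, ae_restrict_mem hs] with x hx hxe hxs
    refine ⟨hxs, le_trans (lintegral_mono_ae ?_) hx⟩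
    filter_upwards [hxe] with ν hν
    rw [← hν]
    exact Real.ofReal_le_enorm _
  refine ⟨fun x ν => T.indicator (fun z => ENNReal.ofReal (G (z, ν))) x, ?_, fun x => ?_, ?_⟩
  · have : (fun p : X × ℝ => T.indicator (fun z => ENNReal.ofReal (G (z, p.2))) p.1) =
        (Prod.fst ⁻¹' T).indicator fun p : X × ℝ => ENNReal.ofReal (G p) := by
      ext p
      by_cases hp : p.1 ∈ T
      · rw [indicator_of_mem hp, indicator_of_mem (by exact hp)]
      · rw [indicator_of_notMem hp, indicator_of_notMem (by exact hp)]
    rw [this]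
    exact hGm'.indicator (measurable_fst hTm)
  · by_cases hx : x ∈ T
    · simp only [indicator_of_mem hx]; exact hx.2
    · simp [indicator_of_notMem hx]
  · have hGe' : ∀ᵐ p ∂(μ.prod freqMeasure), p.1 ∈ s → (0 ≤ g p.1 p.2 ∧ g p.1 p.2 = G p) := by
      have h := h0.and hGe
      have hres : (μ.restrict s).prod freqMeasure =
          (μ.prod freqMeasure).restrict (s ×ˢ univ) := by
        rw [← Measure.prod_restrict, Measure.restrict_univ]
      rw [hres, ae_restrict_iff' (hs.prod .univ)] at h
      filter_upwards [h] with p hp hps using hp ⟨hps, mem_univ _⟩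
    filter_upwards [hGe', Measure.quasiMeasurePreserving_fst.ae hTae] with p hp hpT
    by_cases hps : p.1 ∈ s
    · rw [indicator_of_mem hps, indicator_of_mem (hpT hps), (hp hps).2]
      exact ⟨(hp hps).2 ▸ (hp hps).1, rfl⟩
    · rw [indicator_of_notMem hps, indicator_of_notMem fun h => hps h.1]
      simp

theorem IsNonnegLinftyL1.ae_lintegral_le {X : Type*} [MeasurableSpace X] {μ : Measure X}
    {g : X → ℝ → ℝ} {M : ℝ≥0} (h : IsNonnegLinftyL1 μ g M) :
    ∀ᵐ x ∂μ, ∫⁻ ν, ‖g x ν‖ₑ ∂freqMeasure ≤ M :=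
  (ENNReal.ae_le_essSup _).mono fun _ hx => hx.trans h.norm_le

/-- Bounds on each slice pass to the product only for measurable sets, hence the detour through the
measurable modification `G`. -/
theorem ae_prod_nonneg_and_lintegral_le {X Y : Type*} [MeasurableSpace X] [MeasurableSpace Y]
    {μ : Measure X} {κ : Measure Y} [SFinite μ] [SFinite κ] {g : X → Y → ℝ → ℝ} {M : ℝ≥0}
    (hm : AEMeasurable (fun p : X × Y × ℝ => g p.1 p.2.1 p.2.2) (μ.prod (κ.prod freqMeasure)))
    (hg : ∀ x, IsNonnegLinftyL1 κ (g x) M) :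
    (∀ᵐ p : X × Y × ℝ ∂(μ.prod (κ.prod freqMeasure)), 0 ≤ g p.1 p.2.1 p.2.2) ∧
      ∀ᵐ p ∂(μ.prod κ), ∫⁻ ν, ‖g p.1 p.2 ν‖ₑ ∂freqMeasure ≤ M := by
  set G := hm.mk _ with hG
  have hGm : Measurable G := hm.measurable_mk
  have hGe : ∀ᵐ p ∂(μ.prod (κ.prod freqMeasure)), g p.1 p.2.1 p.2.2 = G p := hm.ae_eq_mk
  have hGe1 := Measure.ae_ae_of_ae_prod hGe
  constructor
  · have h1 : ∀ᵐ p ∂(μ.prod (κ.prod freqMeasure)), 0 ≤ G p := by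
      rw [Measure.ae_prod_iff_ae_ae (measurableSet_le measurable_const hGm)]
      filter_upwards [hGe1] with x hx
      filter_upwards [hx, (hg x).nonneg] with q hq hq0
      rw [← hq]; exact hq0
    filter_upwards [h1, hGe] with p hp hpe
    rw [hpe]; exact hp
  · have hGe2 : ∀ᵐ p : X × Y ∂(μ.prod κ), ∀ᵐ ν ∂freqMeasure, g p.1 p.2 ν = G (p.1, p.2, ν) := by
      have h := (measurePreserving_prodAssoc μ κ freqMeasure).quasiMeasurePreserving.ae hGe
      exact Measure.ae_ae_of_ae_prod h
    have hGm' : Measurable fun p : X × Y => ∫⁻ ν, ‖G (p.1, p.2, ν)‖ₑ ∂freqMeasure := by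
      refine Measurable.lintegral_prod_right'
        (f := fun q : (X × Y) × ℝ => ‖G (q.1.1, q.1.2, q.2)‖ₑ) ?_
      exact (hGm.comp (by fun_prop)).enorm
    have h1 : ∀ᵐ p : X × Y ∂(μ.prod κ), ∫⁻ ν, ‖G (p.1, p.2, ν)‖ₑ ∂freqMeasure ≤ M := by
      rw [Measure.ae_prod_iff_ae_ae (measurableSet_le hGm' measurable_const)]
      filter_upwards [hGe1] with x hx
      filter_upwards [Measure.ae_ae_of_ae_prod hx, (hg x).ae_lintegral_le] with y hy hyM
      refine le_trans (le_of_eq (lintegral_congr_ae ?_)) hyM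
      filter_upwards [hy] with ν hν
      rw [hν]
    filter_upwards [h1, hGe2] with p hp hpe
    refine le_trans (le_of_eq (lintegral_congr_ae ?_)) hp
    filter_upwards [hpe] with ν hν
    rw [hν]

/-! ### Null sets seen along rays. -/

/-- For each `t` the shift by `d t` preserves Lebesgue measure, so the skew map `(t, x) ↦ (t, x - d
t)` preserves the product and pulls null sets back to null sets; Fubini then fixes `x` first. -/
theorem ae_ae_translate {Z T : Type*} [MeasurableSpace Z] [MeasurableSpace T] {τ : Measure T}
    {ζ : Measure Z} [SFinite τ] [SFinite ζ] {c : T → Z}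
    (hc : Measure.QuasiMeasurePreserving c τ ζ)
    {d : T → E3} (hd : Measurable d) {P : Z → E3 → Prop}
    (h : ∀ᵐ p ∂(ζ.prod (volume : Measure E3)), P p.1 p.2) :
    ∀ᵐ x : E3, ∀ᵐ t ∂τ, P (c t) (x - d t) := by
  have h1 : MeasurePreserving (fun p : T × E3 => (p.1, p.2 - d p.1))
      (τ.prod volume) (τ.prod volume) :=
    (MeasurePreserving.id τ).skew_product (g := fun t x => x - d t) (by fun_prop)
      (ae_of_all _ fun t => (measurePreserving_sub_right volume (d t)).map_eq)
  have h2 := (QuasiMeasurePreserving.prodMap hc (.id (volume : Measure E3))).comp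
    h1.quasiMeasurePreserving
  have h3 := h2.comp (Measure.measurePreserving_swap (μ := (volume : Measure E3))
    (ν := τ)).quasiMeasurePreserving
  exact Measure.ae_ae_of_ae_prod (h3.ae h)

theorem ae_ray_ae_of_ae {P : E3 → ℝ → Prop}
    (h : ∀ᵐ p ∂((volume : Measure E3).prod freqMeasure), P p.1 p.2) :
    ∀ᵐ x : E3, ∀ᵐ q : S2 × ℝ ∂(sphereMeasure.prod freqMeasure),
      ∀ᵐ l : ℝ, P (x - l • (q.1 : E3)) q.2 := by
  have h1 := (Measure.measurePreserving_swap (μ := freqMeasure)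
    (ν := (volume : Measure E3))).quasiMeasurePreserving.ae h
  have h2 := ae_ae_translate (τ := (sphereMeasure.prod freqMeasure).prod (volume : Measure ℝ))
    (c := fun t => t.1.2) (d := fun t => t.2 • (t.1.1 : E3))
    (Measure.quasiMeasurePreserving_snd.comp Measure.quasiMeasurePreserving_fst)
    (by fun_prop) (P := fun ν y => P y ν) h1
  filter_upwards [h2] with x hx
  exact Measure.ae_ae_of_ae_prod hx

theorem ae_ae_source_of_ae {P : S2 → E3 → ℝ → Prop}
    (h : ∀ᵐ p ∂((sphereMeasure.prod (volume : Measure E3)).prod freqMeasure), P p.1.1 p.1.2 p.2) :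
    ∀ᵐ x : E3, ∀ᵐ q : S2 × ℝ × ℝ ∂(sphereMeasure.prod ((volume : Measure ℝ).prod freqMeasure)),
      P q.1 (x - q.2.1 • (q.1 : E3)) q.2.2 := by
  have hmp : Measure.QuasiMeasurePreserving (fun p : (S2 × ℝ) × E3 => ((p.1.1, p.2), p.1.2))
      ((sphereMeasure.prod freqMeasure).prod volume)
      ((sphereMeasure.prod (volume : Measure E3)).prod freqMeasure) :=
    (((measurePreserving_prodAssoc sphereMeasure (volume : Measure E3) freqMeasure).symm).comp
      (((MeasurePreserving.id sphereMeasure).prod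
        (Measure.measurePreserving_swap (μ := freqMeasure) (ν := (volume : Measure E3)))).comp
        (measurePreserving_prodAssoc sphereMeasure freqMeasure
          (volume : Measure E3)))).quasiMeasurePreserving
  exact ae_ae_translate (P := fun (z : S2 × ℝ) y => P z.1 y z.2)
    (c := fun t : S2 × ℝ × ℝ => (t.1, t.2.2)) (d := fun t => t.2.1 • (t.1 : E3))
    (QuasiMeasurePreserving.prodMap (.id sphereMeasure)
      (Measure.quasiMeasurePreserving_snd (μ := (volume : Measure ℝ)) (ν := freqMeasure)))
    (by fun_prop) (hmp.ae h)

/-! ### Intensities with values in `[0, ∞]` and their monotonicity along rays. -/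

/-- The function `t ↦ exp (-t)` on `[0, ∞]`. -/
noncomputable def expNeg (t : ℝ≥0∞) : ℝ≥0∞ := EReal.exp (-(t : EReal))

theorem measurable_expNeg : Measurable expNeg :=
  EReal.measurable_exp.comp (measurable_coe_ennreal_ereal.neg)

theorem expNeg_antitone : Antitone expNeg := fun s t h =>
  EReal.exp_monotone (EReal.neg_le_neg_iff.2 (by exact_mod_cast h))

theorem expNeg_le_one (t : ℝ≥0∞) : expNeg t ≤ 1 := by
  have h := expNeg_antitone (bot_le : ⊥ ≤ t)
  simpa [expNeg] using h

/-- Finiteness matters: `expNeg ∞` is 0, as monotonicity requires, whereas `toReal` would give `exp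
0 = 1`. -/
theorem expNeg_of_ne_top {t : ℝ≥0∞} (ht : t ≠ ∞) :
    expNeg t = ENNReal.ofReal (Real.exp (-t.toReal)) := by
  rw [expNeg, ← EReal.coe_ennreal_toReal ht, ← EReal.coe_neg, EReal.exp_coe]

theorem setLIntegral_Ioc_add (f : ℝ → ℝ≥0∞) (a b s : ℝ) :
    ∫⁻ l in Ioc a b, f (l + s) = ∫⁻ l in Ioc (a + s) (b + s), f l := by
  have h := (measurePreserving_add_right (volume : Measure ℝ) s).setLIntegral_comp_preimage_emb
    (measurableEmbedding_addRight s) f (Ioc (a + s) (b + s))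
  rw [← h]
  simp

theorem setLIntegral_Ioi_add (f : ℝ → ℝ≥0∞) (a s : ℝ) :
    ∫⁻ l in Ioi a, f (l + s) = ∫⁻ l in Ioi (a + s), f l := by
  have h := (measurePreserving_add_right (volume : Measure ℝ) s).setLIntegral_comp_preimage_emb
    (measurableEmbedding_addRight s) f (Ioi (a + s))
  rw [← h]
  simp

/-- The absorption along the segment of length `r` behind `x`. -/
noncomputable def opticalDepth (ψ : E3 → ℝ → ℝ≥0∞) (x : E3) (n : S2) (r ν : ℝ) : ℝ≥0∞ :=
  ∫⁻ l in Ioc 0 r, ψ (x - l • (n : E3)) ν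

/-- The absorption along the whole half-line behind `x`. -/
noncomputable def totalOpticalDepth (ψ : E3 → ℝ → ℝ≥0∞) (x : E3) (n : S2) (ν : ℝ) : ℝ≥0∞ :=
  ∫⁻ l in Ioi (0 : ℝ), ψ (x - l • (n : E3)) ν

/-- The intensity at `x` in direction `n` of the radiation emitted with density `φ`. -/
noncomputable def emission (φ : S2 × E3 → ℝ → ℝ≥0∞) (ψ : E3 → ℝ → ℝ≥0∞) (L : ℝ) (x : E3)
    (n : S2) : ℝ≥0∞ :=
  ∫⁻ r in Ioc 0 L, ∫⁻ ν, φ (n, x - r • (n : E3)) ν * expNeg (opticalDepth ψ x n r ν) ∂freqMeasure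

/-- The intensity at `x` in direction `n` of the incoming radiation `f`. -/
noncomputable def transmission (f : S2 → ℝ → ℝ≥0∞) (ψ : E3 → ℝ → ℝ≥0∞) (x : E3) (n : S2) :
    ℝ≥0∞ :=
  ∫⁻ ν, f n ν * expNeg (totalOpticalDepth ψ x n ν) ∂freqMeasure

/-- The point at distance `l` behind `x - s n` is at distance `l + s` behind `x`, so the segment on
the left is part of the one on the right. -/
theorem opticalDepth_shift_le (ψ : E3 → ℝ → ℝ≥0∞) (x : E3) (n : S2) {s : ℝ} (hs : 0 ≤ s)
    (r ν : ℝ) : opticalDepth ψ (x - s • (n : E3)) n r ν ≤ opticalDepth ψ x n (r + s) ν := by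
  have h := setLIntegral_Ioc_add (fun l => ψ (x - l • (n : E3)) ν) 0 r s
  have h' : opticalDepth ψ (x - s • (n : E3)) n r ν =
      ∫⁻ l in Ioc 0 r, ψ (x - (l + s) • (n : E3)) ν := by
    refine lintegral_congr fun l => ?_
    congr 1
    module
  rw [h', h]
  exact lintegral_mono_set (Ioc_subset_Ioc_left (by linarith))

theorem totalOpticalDepth_shift_le (ψ : E3 → ℝ → ℝ≥0∞) (x : E3) (n : S2) {s : ℝ} (hs : 0 ≤ s)
    (ν : ℝ) : totalOpticalDepth ψ (x - s • (n : E3)) n ν ≤ totalOpticalDepth ψ x n ν := by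
  have h := setLIntegral_Ioi_add (fun l => ψ (x - l • (n : E3)) ν) 0 s
  have h' : totalOpticalDepth ψ (x - s • (n : E3)) n ν =
      ∫⁻ l in Ioi (0 : ℝ), ψ (x - (l + s) • (n : E3)) ν := by
    refine lintegral_congr fun l => ?_
    congr 1
    module
  rw [h', h]
  exact lintegral_mono_set (Ioi_subset_Ioi (by linarith))

theorem lintegral_mul_expNeg_le {g t : ℝ → ℝ≥0∞} {M : ℝ≥0∞}
    (hg : ∫⁻ ν, g ν ∂freqMeasure ≤ M) : ∫⁻ ν, g ν * expNeg (t ν) ∂freqMeasure ≤ M :=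
  (lintegral_mono fun _ => mul_le_of_le_one_right' (expNeg_le_one _)).trans hg

theorem emission_le {φ : S2 × E3 → ℝ → ℝ≥0∞} {ψ : E3 → ℝ → ℝ≥0∞} {M : ℝ≥0∞}
    (hφ : ∀ y, ∫⁻ ν, φ y ν ∂freqMeasure ≤ M) (L : ℝ) (x : E3) (n : S2) :
    emission φ ψ L x n ≤ M * ENNReal.ofReal L := by
  calc emission φ ψ L x n ≤ ∫⁻ _r in Ioc 0 L, M :=
        lintegral_mono fun r => lintegral_mul_expNeg_le (hφ _)
    _ = M * ENNReal.ofReal L := by simp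

/-- Sources within distance `s` contribute at most `M s`. The farther ones are also seen from `x - s
n`, through less absorption. -/
theorem emission_le_add {φ : S2 × E3 → ℝ → ℝ≥0∞} {ψ : E3 → ℝ → ℝ≥0∞} {M : ℝ≥0∞}
    (hφ : ∀ y, ∫⁻ ν, φ y ν ∂freqMeasure ≤ M) (L : ℝ) (x : E3) (n : S2) {s : ℝ} (hs : 0 ≤ s) :
    emission φ ψ L x n ≤ emission φ ψ L (x - s • (n : E3)) n + M * ENNReal.ofReal s := by
  set F : ℝ → ℝ≥0∞ := fun r =>
    ∫⁻ ν, φ (n, x - r • (n : E3)) ν * expNeg (opticalDepth ψ x n r ν) ∂freqMeasure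
  have h1 : ∫⁻ r in Ioc 0 s, F r ≤ M * ENNReal.ofReal s :=
    (lintegral_mono fun r => lintegral_mul_expNeg_le (hφ _)).trans (by simp)
  have h2 : ∫⁻ r in Ioc s (L + s), F r ≤ emission φ ψ L (x - s • (n : E3)) n := by
    have h := setLIntegral_Ioc_add F 0 L s
    rw [zero_add] at h
    rw [← h]
    refine lintegral_mono fun r => lintegral_mono fun ν => ?_
    have e : x - (r + s) • (n : E3) = x - s • (n : E3) - r • (n : E3) := by module
    rw [e]
    exact mul_le_mul_right (expNeg_antitone (opticalDepth_shift_le ψ x n hs r ν)) _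
  -- An inclusion suffices, so `s > L` needs no separate case.
  calc emission φ ψ L x n ≤ ∫⁻ r in Ioc 0 s ∪ Ioc s (L + s), F r := by
        refine lintegral_mono_set fun r hr => ?_
        rcases le_or_gt r s with h | h
        · exact Or.inl ⟨hr.1, h⟩
        · exact Or.inr ⟨h, by linarith [hr.2]⟩
    _ ≤ (∫⁻ r in Ioc 0 s, F r) + ∫⁻ r in Ioc s (L + s), F r := lintegral_union_le _ _ _
    _ ≤ _ := by rw [add_comm]; exact add_le_add h2 h1

theorem transmission_le {f : S2 → ℝ → ℝ≥0∞} {ψ : E3 → ℝ → ℝ≥0∞} {M : ℝ≥0∞}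
    (hf : ∀ n, ∫⁻ ν, f n ν ∂freqMeasure ≤ M) (x : E3) (n : S2) :
    transmission f ψ x n ≤ M :=
  lintegral_mul_expNeg_le (hf n)

/-- The absorption is taken over the whole half-line so that moving back only shortens the path; a
segment of fixed length would also gain absorption at its far end. -/
theorem transmission_shift_le (f : S2 → ℝ → ℝ≥0∞) (ψ : E3 → ℝ → ℝ≥0∞) (x : E3) (n : S2) {s : ℝ}
    (hs : 0 ≤ s) : transmission f ψ x n ≤ transmission f ψ (x - s • (n : E3)) n :=
  lintegral_mono fun ν =>
    mul_le_mul_right (expNeg_antitone (totalOpticalDepth_shift_le ψ x n hs ν)) _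

theorem measurable_opticalDepth {ψ : E3 → ℝ → ℝ≥0∞}
    (hψ : Measurable fun p : E3 × ℝ => ψ p.1 p.2) :
    Measurable fun p : (E3 × S2) × ℝ × ℝ => opticalDepth ψ p.1.1 p.1.2 p.2.1 p.2.2 := by
  have h : ∀ p : (E3 × S2) × ℝ × ℝ, opticalDepth ψ p.1.1 p.1.2 p.2.1 p.2.2 =
      ∫⁻ l, {q : ((E3 × S2) × ℝ × ℝ) × ℝ | 0 < q.2 ∧ q.2 ≤ q.1.2.1}.indicator
        (fun q => ψ (q.1.1.1 - q.2 • (q.1.1.2 : E3)) q.1.2.2) (p, l) := fun p => by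
    rw [opticalDepth, ← lintegral_indicator measurableSet_Ioc]
    rfl
  simp only [h]
  refine Measurable.lintegral_prod_right' (Measurable.indicator ?_ ?_)
  · exact hψ.comp (f := fun q : ((E3 × S2) × ℝ × ℝ) × ℝ =>
      (q.1.1.1 - q.2 • (q.1.1.2 : E3), q.1.2.2)) (by fun_prop)
  · exact (measurableSet_lt measurable_const measurable_snd).inter
      (measurableSet_le measurable_snd measurable_fst.snd.fst)

theorem measurable_totalOpticalDepth {ψ : E3 → ℝ → ℝ≥0∞}
    (hψ : Measurable fun p : E3 × ℝ => ψ p.1 p.2) :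
    Measurable fun p : (E3 × S2) × ℝ => totalOpticalDepth ψ p.1.1 p.1.2 p.2 := by
  refine Measurable.lintegral_prod_right' (f := fun q : ((E3 × S2) × ℝ) × ℝ =>
    ψ (q.1.1.1 - q.2 • (q.1.1.2 : E3)) q.1.2) ?_
  exact hψ.comp (f := fun q : ((E3 × S2) × ℝ) × ℝ =>
      (q.1.1.1 - q.2 • (q.1.1.2 : E3), q.1.2)) (by fun_prop)

theorem measurable_emission_integrand {φ : S2 × E3 → ℝ → ℝ≥0∞} {ψ : E3 → ℝ → ℝ≥0∞}
    (hφ : Measurable fun p : (S2 × E3) × ℝ => φ p.1 p.2)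
    (hψ : Measurable fun p : E3 × ℝ => ψ p.1 p.2) :
    Measurable fun p : (E3 × S2) × ℝ × ℝ => φ (p.1.2, p.1.1 - p.2.1 • (p.1.2 : E3)) p.2.2 *
      expNeg (opticalDepth ψ p.1.1 p.1.2 p.2.1 p.2.2) := by
  refine Measurable.mul ?_ (measurable_expNeg.comp (measurable_opticalDepth hψ))
  exact hφ.comp (f := fun p : (E3 × S2) × ℝ × ℝ =>
    ((p.1.2, p.1.1 - p.2.1 • (p.1.2 : E3)), p.2.2)) (by fun_prop)

theorem emission_eq_lintegral_prod {φ : S2 × E3 → ℝ → ℝ≥0∞} {ψ : E3 → ℝ → ℝ≥0∞}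
    (hφ : Measurable fun p : (S2 × E3) × ℝ => φ p.1 p.2)
    (hψ : Measurable fun p : E3 × ℝ => ψ p.1 p.2) (L : ℝ) (x : E3) (n : S2) :
    emission φ ψ L x n = ∫⁻ q, φ (n, x - q.1 • (n : E3)) q.2 *
      expNeg (opticalDepth ψ x n q.1 q.2) ∂((volume.restrict (Ioc 0 L)).prod freqMeasure) :=
  (lintegral_prod _ ((measurable_emission_integrand hφ hψ).comp
    (measurable_prodMk_left (x := (x, n)))).aemeasurable).symm

theorem measurable_emission {φ : S2 × E3 → ℝ → ℝ≥0∞} {ψ : E3 → ℝ → ℝ≥0∞}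
    (hφ : Measurable fun p : (S2 × E3) × ℝ => φ p.1 p.2)
    (hψ : Measurable fun p : E3 × ℝ => ψ p.1 p.2) (L : ℝ) :
    Measurable fun p : E3 × S2 => emission φ ψ L p.1 p.2 := by
  simp only [emission_eq_lintegral_prod hφ hψ]
  exact (measurable_emission_integrand hφ hψ).lintegral_prod_right'

theorem measurable_transmission_integrand {f : S2 → ℝ → ℝ≥0∞} {ψ : E3 → ℝ → ℝ≥0∞}
    (hf : Measurable fun p : S2 × ℝ => f p.1 p.2)
    (hψ : Measurable fun p : E3 × ℝ => ψ p.1 p.2) :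
    Measurable fun p : (E3 × S2) × ℝ =>
      f p.1.2 p.2 * expNeg (totalOpticalDepth ψ p.1.1 p.1.2 p.2) := by
  refine Measurable.mul ?_ (measurable_expNeg.comp (measurable_totalOpticalDepth hψ))
  exact hf.comp (f := fun p : (E3 × S2) × ℝ => (p.1.2, p.2)) (by fun_prop)

theorem measurable_transmission {f : S2 → ℝ → ℝ≥0∞} {ψ : E3 → ℝ → ℝ≥0∞}
    (hf : Measurable fun p : S2 × ℝ => f p.1 p.2)
    (hψ : Measurable fun p : E3 × ℝ => ψ p.1 p.2) :
    Measurable fun p : E3 × S2 => transmission f ψ p.1 p.2 :=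
  (measurable_transmission_integrand hf hψ).lintegral_prod_right'

/-- The value bound is `M L` and the slope is `M`; the constant `M * (L + 1)` dominates both. -/
theorem isRaySemiLipschitz_emission {φ : S2 × E3 → ℝ → ℝ≥0∞} {ψ : E3 → ℝ → ℝ≥0∞} {M : ℝ≥0}
    (hφ : Measurable fun p : (S2 × E3) × ℝ => φ p.1 p.2)
    (hψ : Measurable fun p : E3 × ℝ => ψ p.1 p.2)
    (hM : ∀ y, ∫⁻ ν, φ y ν ∂freqMeasure ≤ M) {L : ℝ} (hL : 0 ≤ L) :
    IsRaySemiLipschitz (fun x n => (emission φ ψ L x n).toReal) (M * (L + 1)) := by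
  have hM0 : (0 : ℝ) ≤ M := M.2
  have hlt : ∀ x n, emission φ ψ L x n ≠ ∞ := fun x n =>
    ((emission_le hM L x n).trans_lt
      (ENNReal.mul_lt_top ENNReal.coe_lt_top ENNReal.ofReal_lt_top)).ne
  refine ⟨(measurable_emission hφ hψ L).ennreal_toReal, fun x n => ENNReal.toReal_nonneg,
    fun x n => ?_, fun x n s hs => ?_⟩
  · have h := ENNReal.toReal_mono (ENNReal.mul_ne_top ENNReal.coe_ne_top ENNReal.ofReal_ne_top)
      (emission_le (ψ := ψ) hM L x n)
    rw [ENNReal.toReal_mul, ENNReal.coe_toReal, ENNReal.toReal_ofReal hL] at h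
    nlinarith
  · have hne : (M : ℝ≥0∞) * ENNReal.ofReal s ≠ ∞ :=
      ENNReal.mul_ne_top ENNReal.coe_ne_top ENNReal.ofReal_ne_top
    have h := ENNReal.toReal_mono (ENNReal.add_ne_top.2 ⟨hlt _ _, hne⟩)
      (emission_le_add (ψ := ψ) hM L x n hs)
    rw [ENNReal.toReal_add (hlt _ _) hne, ENNReal.toReal_mul, ENNReal.coe_toReal,
      ENNReal.toReal_ofReal hs] at h
    have h2 : (0 : ℝ) ≤ M * L * s := by positivity
    linarith

theorem isRaySemiLipschitz_transmission {f : S2 → ℝ → ℝ≥0∞} {ψ : E3 → ℝ → ℝ≥0∞} {M : ℝ≥0}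
    (hf : Measurable fun p : S2 × ℝ => f p.1 p.2)
    (hψ : Measurable fun p : E3 × ℝ => ψ p.1 p.2)
    (hM : ∀ n, ∫⁻ ν, f n ν ∂freqMeasure ≤ M) :
    IsRaySemiLipschitz (fun x n => (transmission f ψ x n).toReal) M := by
  have hlt : ∀ x n, transmission f ψ x n ≠ ∞ := fun x n =>
    ((transmission_le hM x n).trans_lt ENNReal.coe_lt_top).ne
  refine ⟨(measurable_transmission hf hψ).ennreal_toReal, fun x n => ENNReal.toReal_nonneg,
    fun x n => ?_, fun x n s hs => ?_⟩
  · simpa using ENNReal.toReal_mono ENNReal.coe_ne_top (transmission_le (ψ := ψ) hM x n)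
  · have h := ENNReal.toReal_mono (hlt _ _) (transmission_shift_le f ψ x n hs)
    have h2 : (0 : ℝ) ≤ M * s := mul_nonneg M.2 hs
    linarith

/-! ### Identification with the real-valued integrals on almost every ray. -/

/-- Along the ray behind `x`, the representative `ψ'` agrees with `ψ` and is integrable. -/
structure IsRegularRay (Ω : Set E3) (ψ : E3 → ℝ → ℝ) (ψ' : E3 → ℝ → ℝ≥0∞) (x : E3) (n : S2)
    (ν : ℝ) : Prop where
  ae_eq : ∀ᵐ l : ℝ, 0 ≤ zeroExt Ω ψ (x - l • (n : E3)) ν ∧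
    ENNReal.ofReal (zeroExt Ω ψ (x - l • (n : E3)) ν) = ψ' (x - l • (n : E3)) ν
  opticalDepth_lt_top : opticalDepth ψ' x n (Metric.diam Ω) ν < ∞

theorem lintegral_opticalDepth_le {ψ : E3 → ℝ → ℝ≥0∞} {M : ℝ≥0}
    (hψ : Measurable fun p : E3 × ℝ => ψ p.1 p.2)
    (hM : ∀ y, ∫⁻ ν, ψ y ν ∂freqMeasure ≤ M) (x : E3) (n : S2) (r : ℝ) :
    ∫⁻ ν, opticalDepth ψ x n r ν ∂freqMeasure ≤ M * ENNReal.ofReal r := by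
  unfold opticalDepth
  rw [lintegral_lintegral_swap]
  · calc _ ≤ ∫⁻ _l in Ioc 0 r, (M : ℝ≥0∞) := lintegral_mono fun l => hM _
      _ = _ := by simp
  · exact (hψ.comp (f := fun p : ℝ × ℝ => (x - p.2 • (n : E3), p.1))
      (by fun_prop)).aemeasurable

/-- Integrated over frequency, the optical depth is at most `M` times the diameter, hence finite for
almost every direction and frequency by Tonelli. -/
theorem ae_isRegularRay {Ω : Set E3} {ψ : E3 → ℝ → ℝ} {ψ' : E3 → ℝ → ℝ≥0∞} {M : ℝ≥0}
    (hψ : Measurable fun p : E3 × ℝ => ψ' p.1 p.2)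
    (hM : ∀ y, ∫⁻ ν, ψ' y ν ∂freqMeasure ≤ M)
    (he : ∀ᵐ p ∂((volume : Measure E3).prod freqMeasure), 0 ≤ zeroExt Ω ψ p.1 p.2 ∧
      ENNReal.ofReal (zeroExt Ω ψ p.1 p.2) = ψ' p.1 p.2) :
    ∀ᵐ x : E3, ∀ᵐ q : S2 × ℝ ∂(sphereMeasure.prod freqMeasure),
      IsRegularRay Ω ψ ψ' x q.1 q.2 := by
  filter_upwards [ae_ray_ae_of_ae (P := fun y ν => 0 ≤ zeroExt Ω ψ y ν ∧
    ENNReal.ofReal (zeroExt Ω ψ y ν) = ψ' y ν) he] with x hx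
  have hm : Measurable fun q : S2 × ℝ => opticalDepth ψ' x q.1 (Metric.diam Ω) q.2 :=
    (measurable_opticalDepth hψ).comp
      (f := fun q : S2 × ℝ => ((x, q.1), (Metric.diam Ω, q.2))) (by fun_prop)
  have hfin : ∫⁻ q, opticalDepth ψ' x q.1 (Metric.diam Ω) q.2
      ∂(sphereMeasure.prod freqMeasure) ≠ ∞ := by
    rw [lintegral_prod _ hm.aemeasurable]
    refine ((lintegral_mono fun n => lintegral_opticalDepth_le hψ hM x n _).trans_lt ?_).ne
    rw [lintegral_const]
    exact ENNReal.mul_lt_top (ENNReal.mul_lt_top ENNReal.coe_lt_top ENNReal.ofReal_lt_top)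
      (measure_lt_top _ _)
  filter_upwards [hx, ae_lt_top hm hfin] with q h1 h2 using ⟨h1, h2⟩

namespace IsRegularRay

variable {Ω : Set E3} {ψ : E3 → ℝ → ℝ} {ψ' : E3 → ℝ → ℝ≥0∞} {x : E3} {n : S2} {ν : ℝ}

theorem aestronglyMeasurable (h : IsRegularRay Ω ψ ψ' x n ν)
    (hψ : Measurable fun p : E3 × ℝ => ψ' p.1 p.2) :
    AEStronglyMeasurable (fun l : ℝ => zeroExt Ω ψ (x - l • (n : E3)) ν) := by
  have hm : Measurable fun l : ℝ => (ψ' (x - l • (n : E3)) ν).toReal :=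
    (hψ.comp (f := fun l : ℝ => (x - l • (n : E3), ν)) (by fun_prop)).ennreal_toReal
  refine hm.aestronglyMeasurable.congr ?_
  filter_upwards [h.ae_eq] with l hl
  rw [← hl.2, ENNReal.toReal_ofReal hl.1]

theorem lintegral_ofReal (h : IsRegularRay Ω ψ ψ' x n ν) (r : ℝ) :
    ∫⁻ l in Ioc 0 r, ENNReal.ofReal (zeroExt Ω ψ (x - l • (n : E3)) ν) =
      opticalDepth ψ' x n r ν :=
  lintegral_congr_ae (ae_restrict_of_ae (h.ae_eq.mono fun _ hl => hl.2))

theorem integrableOn (h : IsRegularRay Ω ψ ψ' x n ν)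
    (hψ : Measurable fun p : E3 × ℝ => ψ' p.1 p.2) :
    IntegrableOn (fun l : ℝ => zeroExt Ω ψ (x - l • (n : E3)) ν) (Ioc 0 (Metric.diam Ω)) := by
  refine ⟨(h.aestronglyMeasurable hψ).restrict, ?_⟩
  rw [hasFiniteIntegral_iff_ofReal (ae_restrict_of_ae (h.ae_eq.mono fun _ hl => hl.1)),
    h.lintegral_ofReal]
  exact h.opticalDepth_lt_top

theorem ofReal_exp (h : IsRegularRay Ω ψ ψ' x n ν)
    (hψ : Measurable fun p : E3 × ℝ => ψ' p.1 p.2) {r : ℝ} (hr : 0 ≤ r)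
    (hr' : r ≤ Metric.diam Ω) :
    ENNReal.ofReal (Real.exp (-lineIntegral Ω ψ x n r ν)) = expNeg (opticalDepth ψ' x n r ν) := by
  have hlt : opticalDepth ψ' x n r ν < ∞ :=
    (lintegral_mono_set (Ioc_subset_Ioc_right hr')).trans_lt h.opticalDepth_lt_top
  rw [expNeg_of_ne_top hlt.ne, lineIntegral, intervalIntegral.integral_of_le hr,
    integral_eq_lintegral_of_nonneg_ae (ae_restrict_of_ae (h.ae_eq.mono fun _ hl => hl.1))
      (h.aestronglyMeasurable hψ).restrict, h.lintegral_ofReal]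

/-- From `x ∈ Ω`, points farther than the diameter lie outside `Ω`, where the extended coefficient
vanishes. -/
theorem totalOpticalDepth_eq (h : IsRegularRay Ω ψ ψ' x n ν) (hΩ : Bornology.IsBounded Ω)
    (hx : x ∈ Ω) : totalOpticalDepth ψ' x n ν = opticalDepth ψ' x n (Metric.diam Ω) ν := by
  have hz : ∀ᵐ l : ℝ, Metric.diam Ω < l → ψ' (x - l • (n : E3)) ν = 0 := by
    filter_upwards [h.ae_eq] with l hl hlD
    have hl0 : 0 < l := Metric.diam_nonneg.trans_lt hlD
    have hnot : x - l • (n : E3) ∉ Ω := fun hmem => by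
      have hd := Metric.dist_le_diam_of_mem hΩ hx hmem
      rw [dist_eq_norm, sub_sub_cancel, norm_smul, Real.norm_of_nonneg hl0.le,
        norm_eq_of_mem_sphere, mul_one] at hd
      linarith
    rw [← hl.2, zeroExt, indicator_of_notMem hnot, ENNReal.ofReal_zero]
  refine le_antisymm ?_ (lintegral_mono_set Ioc_subset_Ioi_self)
  rw [totalOpticalDepth, ← Ioc_union_Ioi_eq_Ioi (Metric.diam_nonneg (s := Ω))]
  refine (lintegral_union_le _ _ _).trans ?_
  rw [setLIntegral_congr_fun_ae (g := fun _ => 0) measurableSet_Ioi hz]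
  simp [opticalDepth]

end IsRegularRay

/-! ### The emission and boundary terms as directional averages. -/

theorem interiorConverges_and_interiorTerm_ae_eq {Ω : Set E3} (hΩm : MeasurableSet Ω)
    {φ : S2 → E3 → ℝ → ℝ} {Mφ : ℝ≥0}
    (hφm : AEMeasurable (fun p : S2 × E3 × ℝ => φ p.1 p.2.1 p.2.2)
      (sphereMeasure.prod ((volume.restrict Ω).prod freqMeasure)))
    (hφ : ∀ n, IsNonnegLinftyL1 (volume.restrict Ω) (φ n) Mφ)
    {ψ : E3 → ℝ → ℝ} {Mψ : ℝ≥0} (hψ : IsNonnegLinftyL1 (volume.restrict Ω) ψ Mψ) :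
    InteriorConverges Ω φ ψ ∧ ∃ A, IsRaySemiLipschitz A (Mφ * (Metric.diam Ω + 1)) ∧
      interiorTerm Ω φ ψ =ᵐ[volume.restrict Ω] dirAvg A := by
  obtain ⟨ψ', hψ'm, hψ'M, hψ'e⟩ := exists_measurable_representative hΩm hψ.aemeasurable
    hψ.nonneg hψ.ae_lintegral_le
  obtain ⟨hφ0, hφM⟩ := ae_prod_nonneg_and_lintegral_le hφm hφ
  have hassoc := (measurePreserving_prodAssoc sphereMeasure
    ((volume : Measure E3).restrict Ω) freqMeasure).quasiMeasurePreserving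
  have hres : sphereMeasure.prod ((volume : Measure E3).restrict Ω) =
      (sphereMeasure.prod volume).restrict (univ ×ˢ Ω) := by
    rw [← Measure.prod_restrict, Measure.restrict_univ]
  have hφm' := hφm.comp_quasiMeasurePreserving hassoc
  have hφ0' := hassoc.ae hφ0
  rw [hres] at hφm' hφ0' hφM
  -- Direction and position together form the base space, so one jointly measurable representative
  -- serves all directions.
  obtain ⟨φ', hφ'm, hφ'M, hφ'e⟩ := exists_measurable_representative
    (g := fun (p : S2 × E3) ν => φ p.1 p.2 ν) (MeasurableSet.univ.prod hΩm) hφm' hφ0' hφM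
  have hφ'e' : ∀ᵐ p ∂((sphereMeasure.prod (volume : Measure E3)).prod freqMeasure),
      0 ≤ zeroExt Ω (φ p.1.1) p.1.2 p.2 ∧
        ENNReal.ofReal (zeroExt Ω (φ p.1.1) p.1.2 p.2) = φ' (p.1.1, p.1.2) p.2 := by
    filter_upwards [hφ'e] with p hp
    have hind : (univ ×ˢ Ω).indicator (fun z : S2 × E3 => φ z.1 z.2 p.2) p.1 =
        zeroExt Ω (φ p.1.1) p.1.2 p.2 := by
      by_cases h : p.1.2 ∈ Ω
      · rw [zeroExt, indicator_of_mem h,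
          indicator_of_mem (s := univ ×ˢ Ω) (Set.mk_mem_prod (mem_univ p.1.1) h)]
      · rw [zeroExt, indicator_of_notMem h, indicator_of_notMem fun hh => h hh.2]
    rw [hind] at hp
    exact hp
  set D := Metric.diam Ω with hD
  have hD0 : 0 ≤ D := Metric.diam_nonneg
  set κ := sphereMeasure.prod ((volume.restrict (Ioc 0 D)).prod freqMeasure) with hκ
  have hκac : κ ≪ sphereMeasure.prod ((volume : Measure ℝ).prod freqMeasure) :=
    Measure.AbsolutelyContinuous.rfl.prod
      (Measure.absolutelyContinuous_restrict.prod Measure.AbsolutelyContinuous.rfl)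
  set g : E3 → S2 × ℝ × ℝ → ℝ≥0∞ := fun x q =>
    φ' (q.1, x - q.2.1 • (q.1 : E3)) q.2.2 * expNeg (opticalDepth ψ' x q.1 q.2.1 q.2.2) with hg
  have hgm : ∀ x, Measurable (g x) := fun x =>
    (measurable_emission_integrand hφ'm hψ'm).comp
      (f := fun q : S2 × ℝ × ℝ => ((x, q.1), q.2)) (by fun_prop)
  have hgint : ∀ x, ∫⁻ q, g x q ∂κ = ∫⁻ n, emission φ' ψ' D x n ∂sphereMeasure := fun x => by
    rw [hκ, lintegral_prod _ (hgm x).aemeasurable]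
    exact lintegral_congr fun n => (emission_eq_lintegral_prod hφ'm hψ'm D x n).symm
  have hgfin : ∀ x, ∫⁻ q, g x q ∂κ ≠ ∞ := fun x => by
    rw [hgint]
    refine ((lintegral_mono fun n => emission_le hφ'M D x n).trans_lt ?_).ne
    rw [lintegral_const]
    exact ENNReal.mul_lt_top (ENNReal.mul_lt_top ENNReal.coe_lt_top ENNReal.ofReal_lt_top)
      (measure_lt_top _ _)
  have key : ∀ᵐ x : E3, (fun q : S2 × ℝ × ℝ => interiorIntegrand Ω φ ψ x q.1 q.2.1 q.2.2)
      =ᵐ[κ] fun q => (g x q).toReal := by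
    filter_upwards [ae_ae_source_of_ae (P := fun n y ν => 0 ≤ zeroExt Ω (φ n) y ν ∧
      ENNReal.ofReal (zeroExt Ω (φ n) y ν) = φ' (n, y) ν) hφ'e',
      ae_isRegularRay hψ'm hψ'M hψ'e] with x h1 h2
    -- Regularity of a ray does not involve `r`, so it pulls back along the projection forgetting
    -- `r`.
    have h2' : ∀ᵐ q ∂κ, IsRegularRay Ω ψ ψ' x q.1 q.2.2 :=
      (QuasiMeasurePreserving.prodMap (.id sphereMeasure)
        (Measure.quasiMeasurePreserving_snd (μ := (volume.restrict (Ioc 0 D)))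
          (ν := freqMeasure))).ae h2
    have h3 : ∀ᵐ q ∂κ, q.2.1 ∈ Ioc 0 D :=
      Measure.quasiMeasurePreserving_snd.ae (Measure.quasiMeasurePreserving_fst.ae
        (ae_restrict_mem measurableSet_Ioc))
    filter_upwards [hκac.ae_le h1, h2', h3] with q hq1 hq2 hq3
    rw [hg, interiorIntegrand]
    simp only
    rw [← hq2.ofReal_exp hψ'm hq3.1.le hq3.2, ENNReal.toReal_mul,
      ENNReal.toReal_ofReal (Real.exp_pos _).le, ← hq1.2, ENNReal.toReal_ofReal hq1.1]
  have keyint : ∀ᵐ x : E3, Integrable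
      (fun q : S2 × ℝ × ℝ => interiorIntegrand Ω φ ψ x q.1 q.2.1 q.2.2) κ := by
    filter_upwards [key] with x hx
    exact (integrable_toReal_of_lintegral_ne_top (hgm x).aemeasurable (hgfin x)).congr hx.symm
  refine ⟨ae_restrict_of_ae keyint, fun x n => (emission φ' ψ' D x n).toReal,
    isRaySemiLipschitz_emission hφ'm hψ'm hφ'M hD0, ae_restrict_of_ae ?_⟩
  filter_upwards [key, keyint] with x hx hxi
  have hem : Measurable fun n => emission φ' ψ' D x n :=
    (measurable_emission hφ'm hψ'm D).comp measurable_prodMk_left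
  calc interiorTerm Ω φ ψ x
      = ∫ q, interiorIntegrand Ω φ ψ x q.1 q.2.1 q.2.2 ∂κ := by
        rw [interiorTerm, hκ, integral_prod _ hxi]
        refine integral_congr_ae ?_
        filter_upwards [hxi.prod_right_ae] with n hn
        rw [intervalIntegral.integral_of_le hD0, integral_prod _ hn]
    _ = ∫ q, (g x q).toReal ∂κ := integral_congr_ae hx
    _ = (∫⁻ n, emission φ' ψ' D x n ∂sphereMeasure).toReal := by
        rw [integral_toReal (hgm x).aemeasurable (ae_lt_top (hgm x) (hgfin x)), hgint]
    _ = dirAvg (fun x n => (emission φ' ψ' D x n).toReal) x := by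
        rw [dirAvg, integral_toReal hem.aemeasurable]
        exact ae_of_all _ fun n => (emission_le hφ'M D x n).trans_lt
          (ENNReal.mul_lt_top ENNReal.coe_lt_top ENNReal.ofReal_lt_top)

theorem boundaryConverges_and_boundaryTerm_ae_eq {Ω : Set E3} (hΩm : MeasurableSet Ω)
    (hΩb : Bornology.IsBounded Ω)
    {f : S2 → ℝ → ℝ} {Mf : ℝ≥0} (hf : IsNonnegLinftyL1 sphereMeasure f Mf)
    {ψ : E3 → ℝ → ℝ} {Mψ : ℝ≥0} (hψ : IsNonnegLinftyL1 (volume.restrict Ω) ψ Mψ) :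
    BoundaryConverges Ω f ψ ∧ ∃ A, IsRaySemiLipschitz A Mf ∧
      boundaryTerm Ω f ψ =ᵐ[volume.restrict Ω] dirAvg A := by
  obtain ⟨ψ', hψ'm, hψ'M, hψ'e⟩ := exists_measurable_representative hΩm hψ.aemeasurable
    hψ.nonneg hψ.ae_lintegral_le
  obtain ⟨f', hf'm, hf'M, hf'e⟩ := exists_measurable_representative (μ := sphereMeasure)
    (s := univ) .univ (by simpa using hf.aemeasurable) (by simpa using hf.nonneg)
    (by simpa using hf.ae_lintegral_le)
  simp only [indicator_univ] at hf'e
  set κ := sphereMeasure.prod freqMeasure with hκ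
  set g : E3 → S2 × ℝ → ℝ≥0∞ := fun x q =>
    f' q.1 q.2 * expNeg (totalOpticalDepth ψ' x q.1 q.2) with hg
  have hgm : ∀ x, Measurable (g x) := fun x =>
    (measurable_transmission_integrand hf'm hψ'm).comp
      (f := fun q : S2 × ℝ => ((x, q.1), q.2)) (by fun_prop)
  have hgint : ∀ x, ∫⁻ q, g x q ∂κ = ∫⁻ n, transmission f' ψ' x n ∂sphereMeasure := fun x =>
    lintegral_prod _ (hgm x).aemeasurable
  have hgfin : ∀ x, ∫⁻ q, g x q ∂κ ≠ ∞ := fun x => by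
    rw [hgint]
    refine ((lintegral_mono fun n => transmission_le hf'M x n).trans_lt ?_).ne
    rw [lintegral_const]
    exact ENNReal.mul_lt_top ENNReal.coe_lt_top (measure_lt_top _ _)
  have key : ∀ᵐ x ∂(volume.restrict Ω),
      (fun q : S2 × ℝ => boundaryIntegrand Ω f ψ x q.1 q.2) =ᵐ[κ] fun q => (g x q).toReal := by
    filter_upwards [ae_restrict_of_ae (ae_isRegularRay hψ'm hψ'M hψ'e),
      ae_restrict_mem hΩm] with x h2 hxΩ
    filter_upwards [hf'e, h2] with q hq1 hq2
    rw [hg, boundaryIntegrand]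
    simp only
    rw [hq2.totalOpticalDepth_eq hΩb hxΩ, ← hq2.ofReal_exp hψ'm Metric.diam_nonneg le_rfl,
      ENNReal.toReal_mul, ENNReal.toReal_ofReal (Real.exp_pos _).le, ← hq1.2,
      ENNReal.toReal_ofReal hq1.1]
  have keyint : ∀ᵐ x ∂(volume.restrict Ω), Integrable
      (fun q : S2 × ℝ => boundaryIntegrand Ω f ψ x q.1 q.2) κ := by
    filter_upwards [key] with x hx
    exact (integrable_toReal_of_lintegral_ne_top (hgm x).aemeasurable (hgfin x)).congr hx.symm
  refine ⟨keyint, fun x n => (transmission f' ψ' x n).toReal,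
    isRaySemiLipschitz_transmission hf'm hψ'm hf'M, ?_⟩
  filter_upwards [key, keyint] with x hx hxi
  have hem : Measurable fun n => transmission f' ψ' x n :=
    (measurable_transmission hf'm hψ'm).comp measurable_prodMk_left
  calc boundaryTerm Ω f ψ x
      = ∫ q, boundaryIntegrand Ω f ψ x q.1 q.2 ∂κ := (integral_prod _ hxi).symm
    _ = ∫ q, (g x q).toReal ∂κ := integral_congr_ae hx
    _ = (∫⁻ n, transmission f' ψ' x n ∂sphereMeasure).toReal := by
        rw [integral_toReal (hgm x).aemeasurable (ae_lt_top (hgm x) (hgfin x)), hgint]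
    _ = dirAvg (fun x n => (transmission f' ψ' x n).toReal) x := by
        rw [dirAvg, integral_toReal hem.aemeasurable]
        exact ae_of_all _ fun n => (transmission_le hf'M x n).trans_lt ENNReal.coe_lt_top

theorem lineIntegralsConverge {Ω : Set E3} (hΩm : MeasurableSet Ω)
    {ψ : E3 → ℝ → ℝ} {Mψ : ℝ≥0} (hψ : IsNonnegLinftyL1 (volume.restrict Ω) ψ Mψ) :
    LineIntegralsConverge Ω ψ := by
  obtain ⟨ψ', hψ'm, hψ'M, hψ'e⟩ := exists_measurable_representative hΩm hψ.aemeasurable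
    hψ.nonneg hψ.ae_lintegral_le
  refine ae_restrict_of_ae ?_
  filter_upwards [ae_isRegularRay hψ'm hψ'M hψ'e] with x hx
  filter_upwards [hx] with q hq
  exact hq.integrableOn hψ'm

theorem interior_converges_and_compact {Ω : Set E3} (hΩm : MeasurableSet Ω)
    (hΩb : Bornology.IsBounded Ω)
    {φ : ℕ → S2 → E3 → ℝ → ℝ} {Mφ : ℝ≥0}
    (hφm : ∀ j, AEMeasurable (fun p : S2 × E3 × ℝ => φ j p.1 p.2.1 p.2.2)
      (sphereMeasure.prod ((volume.restrict Ω).prod freqMeasure)))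
    (hφ : ∀ j n, IsNonnegLinftyL1 (volume.restrict Ω) (φ j n) Mφ)
    {ψ : ℕ → E3 → ℝ → ℝ} {Mψ : ℝ≥0}
    (hψ : ∀ j, IsNonnegLinftyL1 (volume.restrict Ω) (ψ j) Mψ) :
    (∀ j, InteriorConverges Ω (φ j) (ψ j)) ∧
      CompactInL2 Ω (fun j => interiorTerm Ω (φ j) (ψ j)) := by
  have h := fun j => interiorConverges_and_interiorTerm_ae_eq hΩm (hφm j) (hφ j) (hψ j)
  choose A hA hAe using fun j => (h j).2
  exact ⟨fun j => (h j).1, compactInL2_of_ae_eq_dirAvg hΩb hA hAe⟩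

theorem mainTheorem10
    (Ω : Set E3) (hΩo : IsOpen Ω) (hΩb : Bornology.IsBounded Ω) (hΩc : Convex ℝ Ω)
    (ψ : ℕ → E3 → ℝ → ℝ) (Mψ : ℝ≥0)
    (hψ : ∀ j, IsNonnegLinftyL1 (volume.restrict Ω) (ψ j) Mψ) :
    (∀ j, LineIntegralsConverge Ω (ψ j)) ∧
    -- emission term with isotropic sources
    (∀ (φ : ℕ → E3 → ℝ → ℝ) (Mφ : ℝ≥0),
      (∀ j, IsNonnegLinftyL1 (volume.restrict Ω) (φ j) Mφ) →
      (∀ j, InteriorConverges Ω (fun _ => φ j) (ψ j)) ∧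
        CompactInL2 Ω (fun j => interiorTerm Ω (fun _ => φ j) (ψ j))) ∧
    -- boundary term
    (∀ (f : S2 → ℝ → ℝ) (Mf : ℝ≥0), IsNonnegLinftyL1 sphereMeasure f Mf →
      (∀ j, BoundaryConverges Ω f (ψ j)) ∧
        CompactInL2 Ω (fun j => boundaryTerm Ω f (ψ j))) ∧
    -- emission term with direction-dependent, uniformly equicontinuous sources
    (∀ (φ : ℕ → S2 → E3 → ℝ → ℝ) (Mφ : ℝ≥0) (σ : ℝ → ℝ),
      (∀ j, AEMeasurable (fun p : S2 × E3 × ℝ => φ j p.1 p.2.1 p.2.2)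
        (sphereMeasure.prod ((volume.restrict Ω).prod freqMeasure))) →
      (∀ j n, IsNonnegLinftyL1 (volume.restrict Ω) (φ j n) Mφ) →
      ContinuousOn σ (Ici 0) → (∀ t, 0 ≤ t → 0 ≤ σ t) → σ 0 = 0 →
      (∀ j (ω₁ ω₂ : S2),
        linftyL1Norm (volume.restrict Ω) (fun x ν => φ j ω₁ x ν - φ j ω₂ x ν) ≤
          ENNReal.ofReal (σ (InnerProductGeometry.angle (ω₁ : E3) (ω₂ : E3)))) →
      (∀ j, InteriorConverges Ω (φ j) (ψ j)) ∧
        CompactInL2 Ω (fun j => interiorTerm Ω (φ j) (ψ j))) := by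
  have hΩm := hΩo.measurableSet
  refine ⟨fun j => lineIntegralsConverge hΩm (hψ j), fun φ Mφ hφ => ?_, fun f Mf hf => ?_,
    fun φ Mφ σ hφm hφ _ _ _ _ => interior_converges_and_compact hΩm hΩb hφm hφ hψ⟩
  · exact interior_converges_and_compact hΩm hΩb (fun j =>
      (hφ j).aemeasurable.comp_quasiMeasurePreserving Measure.quasiMeasurePreserving_snd)
      (fun j _ => hφ j) hψ
  · have h := fun j => boundaryConverges_and_boundaryTerm_ae_eq hΩm hΩb hf (hψ j)
    choose A hA hAe using fun j => (h j).2
    exact ⟨fun j => (h j).1, compactInL2_of_ae_eq_dirAvg hΩb hA hAe⟩
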